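/- **Definitions.** For $\Re p>0$ and real $\nu\ge 0$ let $$B_{p,\nu}(x,y)=\sqrt{\tfrac{2p}{\pi}}\int_0^1 t^{x-\frac32}(1-t)^{y-\frac32}K_{\nu+\frac12}\!\left(\tfrac{p}{t(1-t)}\right)dt,$$ where $K_\nu(z)=\sqrt\pi\,(2z)^\nu e^{-z}U(\nu+\tfrac12,2\nu+1,2z)$ is the modified Bessel function of the second kind ($U$ is the confluent hypergeometric function of the second kind). For $\Re c_1>\Re b_1>0$, $b_2,b_3\in\mathbb C$ let $$F_{1,p,\nu}(b_1,b_2,b_3;c_1;x,y)=\sum_{m,n=0}^\infty \frac{(b_2)_m(b_3)_n\,B_{p,\nu}(b_1+m+n,c_1-b_1)}{B(b_1,c_1-b_1)}\frac{x^m}{m!}\frac{y^n}{n!}\qquad(|x|<1,\ |y|<1),$$ continued analytically to $|\arg(1-x)|<\pi$, $|\arg(1-y)|<\pi$, where $(b)_m$ is the Pochhammer symbol and $B$ the Beta function. Let $$G^{m,n}_{r,q}\!\left(z\,\Big|\,{\alpha_1,\dots,\alpha_r\atop \beta_1,\dots,\beta_q}\right)=\frac1{2\pi i}\int_{-i\infty}^{i\infty}\frac{\prod_{j=1}^m\Gamma(\beta_j-\zeta)\prod_{j=1}^n\Gamma(1-\alpha_j+\zeta)}{\prod_{j=m+1}^q\Gamma(1-\beta_j+\zeta)\prod_{j=n+1}^r\Gamma(\alpha_j-\zeta)}\,z^\zeta\,d\zeta$$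 be Meijer's $G$-function, the path separating the poles of the $\Gamma(\beta_j-\zeta)$, $1\le j\le m$ (on its right), from those of the $\Gamma(1-\alpha_j+\zeta)$, $1\le j\le n$ (on its left); it is defined for $|\arg z|<\pi(m+n-\frac12(r+q))$ on the Riemann surface of the logarithm, provided no pole of the first kind coincides with one of the second. All other powers are principal. **Theorem 1.** Let $\Re p>0$, $\nu\ge0$, $\Re c_1>\Re b_1>0$, $b_2,b_3,\mu\in\mathbb C$ ($\mu$ is a free parameter). The double series converges absolutely for $|x|,|y|<1$ and has a holomorphic continuation to $|\arg(1-x)|<\pi$, $|\arg(1-y)|<\pi$. For all such $x,y$ the following representations hold, with absolutely convergent integrals; in (2) and (4) it is assumed in addition that $\nu\notin\{0,1,2,\dots\}$. Write $F=F_{1,p,\nu}(b_1,b_2,b_3;c_1;x,y)$ and $\Lambda=\dfrac{\Gamma(c_1)}{\Gamma(b_1)\Gamma(c_1-b_1)}$. (1) $$F=\Lambda\sqrt{2p}\int_0^1 t^{b_1-\frac32}(1-t)^{c_1-b_1-\frac32}(1-xt)^{-b_2}(1-yt)^{-b_3}\,e^{\frac p{t(1-t)}}\,G^{2,0}_{1,2}\!\left(\tfrac{2p}{t(1-t)}\Big|{\frac12\atop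 \nu+\frac12,\,-\nu-\frac12}\right)dt,$$ (2) $$F=\Lambda\sqrt{2p}\,\frac{\cos\pi(\nu+\frac12)}{\pi}\int_0^1 t^{b_1-\frac32}(1-t)^{c_1-b_1-\frac32}(1-xt)^{-b_2}(1-yt)^{-b_3}\,e^{\frac{-p}{t(1-t)}}\,G^{2,1}_{1,2}\!\left(\tfrac{2p}{t(1-t)}\Big|{\frac12\atop \nu+\frac12,\,-\nu-\frac12}\right)dt,$$ (3) $$F=\Lambda\,\frac{2^{\mu-\frac12}p^{-\mu+\frac12}}{\sqrt\pi}\int_0^1 t^{b_1+\mu-\frac32}(1-t)^{c_1-b_1+\mu-\frac32}(1-xt)^{-b_2}(1-yt)^{-b_3}\,G^{2,0}_{0,2}\!\left(\tfrac{p^2}{4t^2(1-t)^2}\Big|{-\atop \frac{2\mu+2\nu+1}4,\,\frac{2\mu-2\nu-1}4}\right)dt,$$ (4) $$F=\Lambda\,(2p)^{-\mu+\frac12}\,\frac{\cos\pi(\nu+\frac12)}{\pi}\int_0^1 t^{b_1+\mu-\frac32}(1-t)^{c_1-b_1+\mu-\frac32}(1-xt)^{-b_2}(1-yt)^{-b_3}\,e^{\frac{-p}{t(1-t)}}\,G^{2,1}_{1,2}\!\left(\tfrac{2p}{t(1-t)}\Big|{\frac{2\mu+1}2\atop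 \frac{2\mu+2\nu+1}2,\,\frac{2\mu-2\nu-1}2}\right)dt,$$ (5) $$F=\Lambda\,\frac{p^{-\mu+\frac12}2^{2\mu-\frac32}}{\pi^{3/2}}\int_0^1 t^{b_1+\mu-\frac32}(1-t)^{c_1-b_1+\mu-\frac32}(1-xt)^{-b_2}(1-yt)^{-b_3}\,G^{4,0}_{0,4}\!\left(\tfrac{p^4}{(4t)^4(1-t)^4}\Big|{-\atop \frac{2\mu+2\nu+1}8,\,\frac{2\mu+2\nu+5}8,\,\frac{2\mu-2\nu-1}8,\,\frac{2\mu-2\nu+3}8}\right)dt,$$ where in (5) the argument of $G^{4,0}_{0,4}$ is taken with phase $4\arg p\in(-2\pi,2\pi)$. -/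

import Mathlib

noncomputable section

/-- Tricomi's confluent hypergeometric function `U(a, b, z)`, by its Laplace integral, which
represents it for `Re a > 0` and `Re z > 0` (the only range used below). -/
def tricomiU (a b z : ℂ) : ℂ :=
  (Complex.Gamma a)⁻¹ *
    ∫ t in Set.Ioi (0 : ℝ),
      Complex.exp (-(z * t)) * (t : ℂ) ^ (a - 1) * (1 + (t : ℂ)) ^ (b - a - 1)

/-- The modified Bessel function of the second kind (Macdonald function),
`K_ν(z) = √π (2z)^ν e^{-z} U(ν + 1/2, 2ν + 1, 2z)`, for `Re ν > -1/2` and `Re z > 0`. -/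
def besselK (ν z : ℂ) : ℂ :=
  (Real.sqrt Real.pi : ℂ) * (2 * z) ^ ν * Complex.exp (-z) *
    tricomiU (ν + 1 / 2) (2 * ν + 1) (2 * z)

/-- The extended Beta function `B_{p,ν}(x, y)`. -/
def extBeta (p : ℂ) (ν : ℝ) (x y : ℂ) : ℂ :=
  (2 * p / Real.pi) ^ (1 / 2 : ℂ) *
    ∫ t in (0 : ℝ)..1, (t : ℂ) ^ (x - 3 / 2) * (1 - (t : ℂ)) ^ (y - 3 / 2) *
      besselK ((ν : ℂ) + 1 / 2) (p / (t * (1 - t)))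

/-- The general term, indexed by `(m, n)`, of the double series for `F_{1,p,ν}`. -/
def extAppellTerm (p : ℂ) (ν : ℝ) (b1 b2 b3 c1 x y : ℂ) (mn : ℕ × ℕ) : ℂ :=
  (ascPochhammer ℂ mn.1).eval b2 * (ascPochhammer ℂ mn.2).eval b3 *
      extBeta p ν (b1 + mn.1 + mn.2) (c1 - b1) / Complex.betaIntegral b1 (c1 - b1) *
    (x ^ mn.1 / (mn.1.factorial : ℂ)) * (y ^ mn.2 / (mn.2.factorial : ℂ))

/-- The cut plane `|arg (1 - x)| < π`, that is `ℂ \ [1, ∞)`. -/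
def cutPlane : Set ℂ := {x | 1 - x ∈ Complex.slitPlane}

/-- `F` is holomorphic (jointly in both variables) for `|arg (1 - x)| < π`, `|arg (1 - y)| < π`,
and for `|x| < 1`, `|y| < 1` it is the sum of the double series defining `F_{1,p,ν}`. By the
identity theorem there is at most one such `F` on the product of the two cut planes. -/
structure IsExtAppellF1 (p : ℂ) (ν : ℝ) (b1 b2 b3 c1 : ℂ) (F : ℂ → ℂ → ℂ) : Prop where
  hasSum : ∀ x y : ℂ, ‖x‖ < 1 → ‖y‖ < 1 → HasSum (extAppellTerm p ν b1 b2 b3 c1 x y) (F x y)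
  holomorphic : DifferentiableOn ℂ (fun z : ℂ × ℂ => F z.1 z.2) (cutPlane ×ˢ cutPlane)

open Classical in
/-- The extended Appell function `F_{1,p,ν}(b₁, b₂, b₃; c₁; x, y)`: the double series, continued
analytically to `|arg (1 - x)| < π`, `|arg (1 - y)| < π`. -/
def extAppellF1 (p : ℂ) (ν : ℝ) (b1 b2 b3 c1 : ℂ) : ℂ → ℂ → ℂ :=
  if h : ∃ F, IsExtAppellF1 p ν b1 b2 b3 c1 F then h.choose
  else fun x y => ∑' mn : ℕ × ℕ, extAppellTerm p ν b1 b2 b3 c1 x y mn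

/-- The Mellin–Barnes integrand of the Meijer `G`-function of an argument `z` with logarithm `L`;
so `z ^ ζ` is `exp (ζ L)`. The lists are
`a₁ = α₁, …, αₙ`, `a₂ = αₙ₊₁, …, α_p`, `b₁ = β₁, …, βₘ`, `b₂ = βₘ₊₁, …, β_q`. -/
def meijerIntegrand (a₁ a₂ b₁ b₂ : List ℂ) (L ζ : ℂ) : ℂ :=
  ((b₁.map fun β => Complex.Gamma (β - ζ)).prod *
      (a₁.map fun α => Complex.Gamma (1 - α + ζ)).prod) /
    ((b₂.map fun β => Complex.Gamma (1 - β + ζ)).prod *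
      (a₂.map fun α => Complex.Gamma (α - ζ)).prod) * Complex.exp (ζ * L)

/-- The poles of the factors `Γ(1 - αⱼ + ζ)`, `1 ≤ j ≤ n`; they lie to the left of the contour. -/
def meijerLeftPoles (a₁ : List ℂ) : Set ℂ := {ζ | ∃ α ∈ a₁, ∃ k : ℕ, ζ = α - 1 - k}

/-- The residue of `f` at an isolated singularity `w`. -/
def residueAt (f : ℂ → ℂ) (w : ℂ) : ℂ :=
  Filter.limUnder (nhdsWithin (0 : ℝ) (Set.Ioi 0)) fun r : ℝ =>
    (2 * Real.pi * Complex.I)⁻¹ * ∮ ζ in C(w, r), f ζ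

/-- `σ` is the abscissa of a vertical line that has all poles of the `Γ(βⱼ - ζ)`, `1 ≤ j ≤ m`, on
its right, and no pole of the `Γ(1 - αⱼ + ζ)`, `1 ≤ j ≤ n`, on it. Such `σ` always exist. -/
def IsMeijerAbscissa (a₁ b₁ : List ℂ) (σ : ℝ) : Prop :=
  (∀ β ∈ b₁, σ < β.re) ∧ ∀ w ∈ meijerLeftPoles a₁, w.re ≠ σ

/-- The Meijer function `G^{m,n}_{p,q}`, as a function of the logarithm `L` of its argument, i.e.
on the Riemann surface of the logarithm:
`(1 / 2πi) ∫ ∏ Γ(βⱼ - ζ) ∏ Γ(1 - αⱼ + ζ) / (∏ Γ(1 - βⱼ + ζ) ∏ Γ(αⱼ - ζ)) z^ζ dζ`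
along a contour from `-i∞` to `i∞` that separates the poles of the `Γ(βⱼ - ζ)`, which lie on its
right, from those of the `Γ(1 - αⱼ + ζ)`, which lie on its left.
The contour is realised as a vertical line `Re ζ = σ` with all poles of the `Γ(βⱼ - ζ)` on its
right, together with a small positively oriented loop around each of the finitely many poles of the
`Γ(1 - αⱼ + ζ)` that lie on the right of that line; if there is none, it is just the line.
The function is defined when no pole of the first kind is one of the second
(`βⱼ - αᵢ + 1` is never zero or a negative integer), and
`|Im L| < π (m + n - (p + q) / 2)`; it does not depend on the choice of `σ`. -/
def meijerGLog (a₁ a₂ b₁ b₂ : List ℂ) (L : ℂ) : ℂ :=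
  let σ : ℝ := Classical.epsilon (IsMeijerAbscissa a₁ b₁)
  1 / (2 * Real.pi) *
      (∫ τ : ℝ, meijerIntegrand a₁ a₂ b₁ b₂ L ((σ : ℂ) + τ * Complex.I)) +
    ∑ᶠ w ∈ {w ∈ meijerLeftPoles a₁ | σ < w.re}, residueAt (meijerIntegrand a₁ a₂ b₁ b₂ L) w

/-- The Meijer `G`-function of a complex argument `z ≠ 0`, principal branch. -/
def meijerG (a₁ a₂ b₁ b₂ : List ℂ) (z : ℂ) : ℂ := meijerGLog a₁ a₂ b₁ b₂ (Complex.log z)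

/-- `V = A ∫₀¹ f(t) dt`, the integral being absolutely convergent. -/
def EqConstMulIntegral (V A : ℂ) (f : ℝ → ℂ) : Prop :=
  IntervalIntegrable f MeasureTheory.volume 0 1 ∧ V = A * ∫ t in (0 : ℝ)..1, f t

end

/-! ### Euler's integral with complex rate, the Cahen–Mellin formula and Mellin–Barnes integrals of
Laplace type. -/

section MellinBarnes
open Complex MeasureTheory Set Filter Topology

/-! All five formulas are one Euler integral. Expanding `(1 - xt)^(-b2) (1 - yt)^(-b3)` by the
binomial series under the integral for the extended Beta function shows that the double series
equals a constant times the integral of `extBetaKernel` against `appellFactor`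
(`hasSum_extAppellTerm`). The Bessel factor decays exponentially at both endpoints, so this integral
converges and is holomorphic on the product of cut planes. By the identity theorem it is the
continuation of the series (`extAppellF1_eq_integral`).

It remains to write `K_{ν+1/2}(z)`, `z = p / (t (1 - t))`, as Meijer functions. By
`besselK_eq_laplace`, `K_{ν+1/2}(z)` is `(2z)^(ν+1/2) e^(-z)` times the Laplace transform of
`(t(1+t))^ν` at `2z`, up to a constant. Multiplied by `e^(-z)`, `1` or `e^z`, its exponential is
`e^(-w q(t))` with `w q(t) = 2z(1+t)`, `z(1+2t)` or `2zt`. Inserting the Cahen–Mellin integral for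
`e^(-w q)` and exchanging integrals (`integral_Gamma_mul_integral_cpow`) leaves Mellin integrals in
`t`; the first two are beta integrals.

The third diverges at `t = 0` on the lines needed, so finitely many terms of the binomial expansion
of `(1+t)^ν` are subtracted; the Mellin transform of the remainder is given by the same Gamma
quotient, in a shifted strip (`mellin_binomialRemainder`). The subtracted terms are exactly the
residues at the left poles that the vertical line leaves on its right, and the loops in `meijerGLog`
add them back. The duplication formula yields the `G^{4,0}_{0,4}` version. The parameter `μ` is free
because a factor `z^μ` trades powers of `t(1 - t)` for a power of `p` (`cpow_shift_mul_exp_log`). -/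

theorem norm_cpow_mul_exp_neg {a w : ℂ} {t : ℝ} (ht : 0 < t) :
    ‖(t : ℂ) ^ (a - 1) * cexp (-(w * t))‖ = t ^ (a.re - 1) * Real.exp (-w.re * t ^ (1 : ℝ)) := by
  rw [norm_mul, norm_cpow_eq_rpow_re_of_pos ht, norm_exp]
  simp

theorem integrableOn_cpow_mul_exp_neg {a w : ℂ} (ha : 0 < a.re) (hw : 0 < w.re) :
    IntegrableOn (fun t : ℝ => (t : ℂ) ^ (a - 1) * cexp (-(w * t))) (Ioi 0) := by
  refine Integrable.mono' (integrableOn_rpow_mul_exp_neg_mul_rpow (s := a.re - 1) (p := 1)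
    (by linarith) one_pos hw) ?_ ?_
  · exact (by fun_prop : Measurable fun t : ℝ =>
      (t : ℂ) ^ (a - 1) * cexp (-(w * t))).aestronglyMeasurable
  · filter_upwards [ae_restrict_mem measurableSet_Ioi] with t ht
    rw [norm_cpow_mul_exp_neg ht]

/-- The Euler integral for `Γ`, with a complex rate of decay. -/
theorem integral_cpow_mul_exp_neg_of_re_pos {a w : ℂ} (ha : 0 < a.re) (hw : 0 < w.re) :
    ∫ t in Ioi (0 : ℝ), (t : ℂ) ^ (a - 1) * cexp (-(w * t)) = w ^ (-a) * Gamma a := by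
  -- Both sides are holomorphic in `w` on the right half-plane and agree for real `w > 0`, which is
  -- more than the identity theorem needs.
  have hU : IsOpen {w : ℂ | 0 < w.re} := isOpen_lt continuous_const continuous_re
  have hd : DifferentiableOn ℂ
      (fun w : ℂ => ∫ t in Ioi (0 : ℝ), (t : ℂ) ^ (a - 1) * cexp (-(w * t)))
      {w : ℂ | 0 < w.re} := by
    intro w₀ (hw₀ : 0 < w₀.re)
    -- On this neighbourhood the decay rate stays above `w₀.re / 2`, which gives a uniform majorant
    -- for the derivative.
    have hs : {w : ℂ | w₀.re / 2 < w.re} ∈ 𝓝 w₀ :=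
      (isOpen_lt continuous_const continuous_re).mem_nhds (by simp; linarith)
    refine (hasDerivAt_integral_of_dominated_loc_of_deriv_le hs (𝕜 := ℂ)
      (F := fun w t => (t : ℂ) ^ (a - 1) * cexp (-(w * t)))
      (F' := fun w t => (t : ℂ) ^ (a - 1) * (cexp (-(w * t)) * (-t)))
      (bound := fun t => t ^ a.re * Real.exp (-(w₀.re / 2) * t ^ (1 : ℝ)))
      ?_ (integrableOn_cpow_mul_exp_neg ha hw₀) ?_ ?_ ?_ ?_).2.differentiableAt
      |>.differentiableWithinAt
    · exact .of_forall fun w => (by fun_prop : Measurable fun t : ℝ =>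
        (t : ℂ) ^ (a - 1) * cexp (-(w * t))).aestronglyMeasurable
    · exact (by fun_prop : Measurable fun t : ℝ =>
        (t : ℂ) ^ (a - 1) * (cexp (-(w₀ * t)) * (-t))).aestronglyMeasurable
    · filter_upwards [ae_restrict_mem measurableSet_Ioi] with t (ht : 0 < t) w hw
      have hw' : w₀.re / 2 < w.re := hw
      rw [← mul_assoc, norm_mul, norm_cpow_mul_exp_neg ht, norm_neg, norm_real, Real.norm_eq_abs,
        abs_of_pos ht, mul_right_comm, ← Real.rpow_add_one ht.ne', sub_add_cancel, Real.rpow_one]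
      gcongr
    · exact integrableOn_rpow_mul_exp_neg_mul_rpow (by linarith) one_pos (by linarith)
    · refine .of_forall fun t w _ => ?_
      have h : HasDerivAt (fun w : ℂ => -(w * t)) (-t : ℂ) w := by
        simpa using ((hasDerivAt_id w).mul_const (t : ℂ)).fun_neg
      exact h.cexp.const_mul _
  have hg : DifferentiableOn ℂ (fun w : ℂ => w ^ (-a) * Gamma a) {w : ℂ | 0 < w.re} := by
    intro w hw
    exact ((differentiableAt_id.cpow_const (Or.inl hw)).mul_const _).differentiableWithinAt
  refine (hd.analyticOnNhd hU).eqOn_of_preconnected_of_frequently_eq (hg.analyticOnNhd hU)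
    (convex_halfSpace_re_gt 0).isPreconnected (z₀ := 1) (by simp) ?_ hw
  -- Real points accumulating at `1` without meeting it.
  have hlim : Tendsto (fun n : ℕ => (1 : ℂ) + (1 / ((n : ℝ) + 1) : ℝ)) atTop (𝓝[≠] 1) := by
    refine tendsto_nhdsWithin_iff.2 ⟨?_, .of_forall fun n => ?_⟩
    · have := (continuous_ofReal.tendsto 0).comp (tendsto_one_div_add_atTop_nhds_zero_nat (𝕜 := ℝ))
      simpa using this.const_add 1
    · have : (n : ℂ) + 1 ≠ 0 := by exact_mod_cast n.succ_ne_zero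
      simp [this]
  refine hlim.frequently (.of_forall fun n => ?_)
  have hr : (0 : ℝ) < 1 + 1 / ((n : ℝ) + 1) := by positivity
  have h := Complex.integral_cpow_mul_exp_neg_mul_Ioi ha hr
  have hcast : (1 : ℂ) + (1 / ((n : ℝ) + 1) : ℝ) = ((1 + 1 / ((n : ℝ) + 1) : ℝ) : ℂ) := by
    push_cast; ring
  simp only [hcast]
  rw [h, one_div, inv_cpow _ _ (by rw [arg_ofReal_of_nonneg hr.le]; exact Real.pi_pos.ne),
    cpow_neg]

/-- On a vertical line in the right half-plane, `Γ` decays like any `exp (-θ |y|)`, `θ < π / 2`. -/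
theorem norm_Gamma_vertical_le {σ θ : ℝ} (hσ : 0 < σ) (hθ : 0 ≤ θ) (hθ' : θ < Real.pi / 2) :
    ∃ C, ∀ y : ℝ, ‖Gamma (σ + y * I)‖ ≤ C * Real.exp (-θ * |y|) := by
  -- Rotate the ray: at `w = e^(iφ)`, `|φ| = θ`, Euler's integral is bounded by `C` independently of
  -- `y`, while `|w^(-s)| = e^(φ y)`. The sign of `φ` is then matched to that of `y`.
  set C := ∫ t in Ioi (0 : ℝ), t ^ (σ - 1) * Real.exp (-Real.cos θ * t ^ (1 : ℝ)) with hC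
  have key : ∀ φ y : ℝ, |φ| = θ → ‖Gamma (σ + y * I)‖ ≤ C * Real.exp (-φ * y) := by
    intro φ y hφ
    have hcos : Real.cos φ = Real.cos θ := by rw [← hφ, Real.cos_abs]
    have hφ2 : |φ| < Real.pi / 2 := hφ ▸ hθ'
    have hre : (cexp (φ * I)).re = Real.cos θ := by rw [exp_ofReal_mul_I_re, hcos]
    have hpos : 0 < Real.cos θ :=
      Real.cos_pos_of_mem_Ioo ⟨by linarith [Real.pi_pos], hθ'⟩
    have ha : 0 < ((σ : ℂ) + y * I).re := by simpa using hσ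
    have h := integral_cpow_mul_exp_neg_of_re_pos ha (w := cexp (φ * I)) (by rwa [hre])
    have hlog : log (cexp (φ * I)) = φ * I := by
      have := abs_lt.1 hφ2
      rw [log_exp] <;> simp <;> linarith [Real.pi_pos]
    have hn : ‖cexp (φ * I) ^ (-((σ : ℂ) + y * I))‖ = Real.exp (φ * y) := by
      rw [cpow_def_of_ne_zero (exp_ne_zero _), hlog, norm_exp]
      congr 1
      simp
    have h2 : ‖cexp (φ * I) ^ (-((σ : ℂ) + y * I)) * Gamma (σ + y * I)‖ ≤ C := by
      rw [← h]
      refine (norm_integral_le_integral_norm _).trans_eq ?_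
      rw [hC]
      refine setIntegral_congr_fun measurableSet_Ioi fun t ht => ?_
      rw [norm_cpow_mul_exp_neg ht, hre]
      simp
    rw [norm_mul, hn] at h2
    rw [neg_mul, Real.exp_neg, ← div_eq_mul_inv, le_div_iff₀ (Real.exp_pos _)]
    linarith
  refine ⟨C, fun y => ?_⟩
  rcases abs_cases y with ⟨h, _⟩ | ⟨h, _⟩
  · rw [h]; exact key θ y (abs_of_nonneg hθ)
  · rw [h]; simpa using key (-θ) y (by rw [abs_neg, abs_of_nonneg hθ])

theorem integrable_exp_neg_mul_abs {c : ℝ} (hc : 0 < c) :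
    Integrable fun y : ℝ => Real.exp (-c * |y|) := by
  rw [← integrableOn_univ, ← Iic_union_Ioi (a := (0 : ℝ)), integrableOn_union]
  constructor
  · refine (integrableOn_exp_mul_Iic hc 0).congr_fun (fun y (hy : y ≤ 0) => ?_) measurableSet_Iic
    simp [abs_of_nonpos hy]
  · refine (integrableOn_exp_mul_Ioi (neg_lt_zero.2 hc) 0).congr_fun (fun y (hy : 0 < y) => ?_)
      measurableSet_Ioi
    simp [abs_of_pos hy]

theorem continuous_Gamma_vertical {σ : ℝ} (hσ : 0 < σ) :
    Continuous fun y : ℝ => Gamma (σ + y * I) := by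
  rw [continuous_iff_continuousAt]
  intro y
  refine ContinuousAt.comp (f := fun y : ℝ => (σ : ℂ) + y * I) (g := Gamma) ?_ (by fun_prop)
  refine (differentiableAt_Gamma _ fun m h => ?_).continuousAt
  have := congrArg re h
  simp at this
  have : (0 : ℝ) ≤ m := m.cast_nonneg
  linarith

/-- The exponential grows at most like `e^(|arg w| |y|)` with `|arg w| < π/2`, so a decay rate `θ`
for `Γ` strictly between the two wins. -/
theorem integrable_Gamma_mul_exp_log {σ : ℝ} (hσ : 0 < σ) {w : ℂ} (hw : 0 < w.re) :
    Integrable fun y : ℝ => Gamma (σ + y * I) * cexp (-((σ + y * I) * log w)) := by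
  have harg : |w.arg| < Real.pi / 2 := abs_arg_lt_pi_div_two_iff.2 (Or.inl hw)
  obtain ⟨θ, h1, h2⟩ := exists_between harg
  obtain ⟨C, hC⟩ := norm_Gamma_vertical_le hσ ((abs_nonneg _).trans h1.le) h2
  refine ((integrable_exp_neg_mul_abs (sub_pos.2 h1)).const_mul
    (C * Real.exp (-(σ * (log w).re)))).mono' ?_ (.of_forall fun y => ?_)
  · exact ((continuous_Gamma_vertical hσ).mul (by fun_prop)).aestronglyMeasurable
  · rw [norm_mul, norm_exp]
    have : (-(((σ : ℂ) + y * I) * log w)).re = -(σ * (log w).re) + y * w.arg := by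
      simp [log_im]; ring
    rw [this, Real.exp_add]
    have h3 : y * w.arg ≤ |w.arg| * |y| := by
      rw [mul_comm, ← abs_mul]; exact le_abs_self _
    calc ‖Gamma (σ + y * I)‖ * (Real.exp (-(σ * (log w).re)) * Real.exp (y * w.arg))
        ≤ (C * Real.exp (-θ * |y|)) *
          (Real.exp (-(σ * (log w).re)) * Real.exp (|w.arg| * |y|)) := by
          gcongr
          · exact (norm_nonneg _).trans (hC y)
          · exact hC y
      _ = _ := by
        rw [show -(θ - |w.arg|) * |y| = -θ * |y| + |w.arg| * |y| by ring, Real.exp_add]; ring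

/-- The Cahen–Mellin integral. -/
theorem integral_Gamma_mul_exp_log {σ : ℝ} (hσ : 0 < σ) {w : ℂ} (hw : 0 < w.re) :
    ∫ y : ℝ, Gamma (σ + y * I) * cexp (-((σ + y * I) * log w)) =
      2 * Real.pi * cexp (-w) := by
  have hw0 : w ≠ 0 := by rintro rfl; simp at hw
  -- The integrand is the Mellin transform of `t ↦ e^(-wt)` on the line; Mellin inversion is applied
  -- at the point `1`.
  have hm : ∀ y : ℝ, mellin (fun t : ℝ => cexp (-(w * t))) (σ + y * I) =
      Gamma (σ + y * I) * cexp (-((σ + y * I) * log w)) := by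
    intro y
    have := integral_cpow_mul_exp_neg_of_re_pos (a := (σ : ℂ) + y * I) (by simpa using hσ) hw
    simp only [mellin, smul_eq_mul]
    rw [this, cpow_def_of_ne_zero hw0, mul_comm]
    ring_nf
  have h := mellinInv_mellin_eq σ (fun t : ℝ => cexp (-(w * t))) (x := 1) one_pos
    (integrableOn_cpow_mul_exp_neg (a := σ) (by simpa using hσ) hw)
    (by
      have := integrable_Gamma_mul_exp_log hσ hw
      simp_rw [← hm] at this
      exact this)
    (by fun_prop)
  simp only [mellinInv, ofReal_one, one_cpow, one_smul, hm, mul_one] at h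
  rw [← h, real_smul]
  push_cast
  rw [← mul_assoc, mul_one_div_cancel (by simp [Real.pi_ne_zero]), one_mul]

/-- Mellin–Barnes integral of a generalized Laplace transform. -/
theorem integral_Gamma_mul_integral_cpow {σ : ℝ} (hσ : 0 < σ) {w : ℂ} (hw : 0 < w.re)
    {q : ℝ → ℝ} (hq : Measurable q) (hq0 : ∀ t, 0 < t → 0 < q t) {g : ℝ → ℂ}
    (hg : IntegrableOn (fun t => (q t : ℂ) ^ (-(σ : ℂ)) * g t) (Ioi 0)) :
    ∫ y : ℝ, Gamma (σ + y * I) * cexp (-((σ + y * I) * log w)) *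
        ∫ t in Ioi (0 : ℝ), (q t : ℂ) ^ (-((σ : ℂ) + y * I)) * g t =
      2 * Real.pi * ∫ t in Ioi (0 : ℝ), cexp (-(w * q t)) * g t := by
  set A : ℝ → ℂ := fun y => Gamma (σ + y * I) * cexp (-((σ + y * I) * log w)) with hA
  have hAi : Integrable A := integrable_Gamma_mul_exp_log hσ hw
  -- The dependence of `q^(-(σ+iy))` on `y` is a unimodular factor. What is left is a product of a
  -- function of `y` and one of `t`, so Fubini needs integrability only on the line's real point
  -- `σ`.
  have hsplit : ∀ t : ℝ, 0 < t → ∀ y : ℝ, (q t : ℂ) ^ (-((σ : ℂ) + y * I)) =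
      cexp (-(y * I * Real.log (q t))) * (q t : ℂ) ^ (-(σ : ℂ)) := by
    intro t ht y
    have h0 : (q t : ℂ) ≠ 0 := by exact_mod_cast (hq0 t ht).ne'
    rw [cpow_def_of_ne_zero h0, cpow_def_of_ne_zero h0, ← Complex.exp_add,
      ofReal_log (hq0 t ht).le]
    ring_nf
  have hint : Integrable (Function.uncurry fun (y t : ℝ) =>
      cexp (-(y * I * Real.log (q t))) * (A y * ((q t : ℂ) ^ (-(σ : ℂ)) * g t)))
      (volume.prod (volume.restrict (Ioi 0))) := by
    refine Integrable.bdd_mul (c := 1) (hAi.mul_prod hg) ?_ (.of_forall fun z => ?_)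
    · exact (by fun_prop : Measurable fun z : ℝ × ℝ =>
        cexp (-(z.1 * I * Real.log (q z.2)))).aestronglyMeasurable
    · rw [norm_exp]
      simp
  calc _ = ∫ y : ℝ, ∫ t in Ioi (0 : ℝ),
        cexp (-(y * I * Real.log (q t))) * (A y * ((q t : ℂ) ^ (-(σ : ℂ)) * g t)) := by
        congr 1 with y
        rw [← integral_const_mul]
        refine setIntegral_congr_fun measurableSet_Ioi fun t ht => ?_
        rw [hsplit t ht]
        ring
    _ = ∫ t in Ioi (0 : ℝ), ∫ y : ℝ,
        cexp (-(y * I * Real.log (q t))) * (A y * ((q t : ℂ) ^ (-(σ : ℂ)) * g t)) :=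
        integral_integral_swap hint
    _ = ∫ t in Ioi (0 : ℝ), 2 * Real.pi * (cexp (-(w * q t)) * g t) := by
        refine setIntegral_congr_fun measurableSet_Ioi fun t (ht : 0 < t) => ?_
        have hqt := hq0 t ht
        have h0 : (q t : ℂ) ≠ 0 := by exact_mod_cast hqt.ne'
        have hwq : 0 < (w * q t).re := by simp; positivity
        have hw0 : w ≠ 0 := by rintro rfl; simp at hw
        have hl : log (w * q t) = Real.log (q t) + log w := by
          rw [mul_comm, log_ofReal_mul hqt hw0]
        rw [← mul_assoc, ← integral_Gamma_mul_exp_log hσ hwq, ← integral_mul_const]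
        congr 1 with y
        rw [cpow_def_of_ne_zero h0, hl, hA, ofReal_log hqt.le]
        simp only
        rw [show -(((σ : ℂ) + y * I) * (log (q t) + log w)) = -(y * I * log (q t)) +
          (-((σ + y * I) * log w) + (log (q t) * -σ)) by ring, Complex.exp_add, Complex.exp_add]
        ring
    _ = _ := by rw [integral_const_mul]

end MellinBarnes

/-! ### Mellin–Barnes integrals of `e^(-z) K` and `K`. -/

section BesselMellinBarnes
open Complex MeasureTheory Set Filter Topology

theorem image_div_one_add_Ioi : (fun t : ℝ => t / (1 + t)) '' Ioi 0 = Ioo 0 1 := by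
  ext x
  constructor
  · rintro ⟨t, ht : 0 < t, rfl⟩
    have : 0 < 1 + t := by linarith
    exact ⟨by positivity, (div_lt_one this).2 (by linarith)⟩
  · rintro ⟨h0, h1⟩
    have : 0 < 1 - x := by linarith
    refine ⟨x / (1 - x), by simp only [mem_Ioi]; positivity, ?_⟩
    field_simp
    ring

theorem hasDerivAt_div_one_add {t : ℝ} (ht : 0 < t) :
    HasDerivAt (fun t : ℝ => t / (1 + t)) (1 / (1 + t) ^ 2) t := by
  have h := (hasDerivAt_id t).fun_div ((hasDerivAt_id t).const_add 1)
    (by simp; linarith : (1 : ℝ) + id t ≠ 0)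
  convert! h using 1
  simp

theorem monotoneOn_div_one_add : MonotoneOn (fun t : ℝ => t / (1 + t)) (Ioi 0) := by
  intro s (hs : 0 < s) t (ht : 0 < t) hst
  simp only
  rw [div_le_div_iff₀ (by linarith) (by linarith)]
  nlinarith

/-- The scalar factor is the Jacobian of `x = t / (1 + t)`, which carries the half-line onto the
interval of Euler's beta integral. -/
theorem beta_integrand_comp {u v : ℂ} {t : ℝ} (ht : 0 < t) :
    (1 / (1 + t) ^ 2) • (((t / (1 + t) : ℝ) : ℂ) ^ (u - 1) * (1 - ((t / (1 + t) : ℝ) : ℂ)) ^ (v - 1))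
      = (t : ℂ) ^ (u - 1) * (1 + (t : ℂ)) ^ (-(u + v)) := by
  have h1 : 0 < 1 + t := by linarith
  have h1c : (1 + (t : ℂ)) ≠ 0 := by exact_mod_cast h1.ne'
  have e1 : (1 - ((t / (1 + t) : ℝ) : ℂ)) = (1 + (t : ℂ))⁻¹ := by
    push_cast; field_simp; ring
  have e2 : ((t / (1 + t) : ℝ) : ℂ) ^ (u - 1) = (t : ℂ) ^ (u - 1) * ((1 + (t : ℂ)) ^ (u - 1))⁻¹ := by
    rw [div_eq_mul_inv, ofReal_mul, mul_cpow_ofReal_nonneg ht.le (by positivity), ofReal_inv,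
      inv_cpow]
    · push_cast; rfl
    · rw [arg_ofReal_of_nonneg h1.le]; exact Real.pi_pos.ne
  have e3 : (1 + (t : ℂ))⁻¹ ^ (v - 1) = ((1 + (t : ℂ)) ^ (v - 1))⁻¹ := by
    rw [inv_cpow]
    have := arg_ofReal_of_nonneg h1.le
    push_cast at this
    rw [this]; exact Real.pi_pos.ne
  rw [e1, e2, e3, real_smul]
  push_cast
  rw [← cpow_neg, ← cpow_neg, show -(u + v) = -(u - 1) + (-(v - 1) + (-2 : ℂ)) by ring,
    cpow_add _ _ h1c, cpow_add _ _ h1c, cpow_neg _ 2, show (2 : ℂ) = ((2 : ℕ) : ℂ) by norm_num,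
    cpow_natCast]
  ring

/-- The beta integral over the half-line. -/
theorem beta_integral_Ioi {u v : ℂ} (hu : 0 < u.re) (hv : 0 < v.re) :
    IntegrableOn (fun t : ℝ => (t : ℂ) ^ (u - 1) * (1 + (t : ℂ)) ^ (-(u + v))) (Ioi 0) ∧
    ∫ t in Ioi (0 : ℝ), (t : ℂ) ^ (u - 1) * (1 + (t : ℂ)) ^ (-(u + v)) =
      Gamma u * Gamma v / Gamma (u + v) := by
  have hd : ∀ t ∈ Ioi (0 : ℝ), HasDerivWithinAt (fun t : ℝ => t / (1 + t)) (1 / (1 + t) ^ 2)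
    (Ioi 0) t := fun t ht => (hasDerivAt_div_one_add ht).hasDerivWithinAt
  have hc : ∀ t ∈ Ioi (0 : ℝ), _ := fun t ht => beta_integrand_comp (u := u) (v := v) ht
  have hi := integrableOn_image_iff_integrableOn_deriv_smul_of_monotoneOn measurableSet_Ioi hd
    monotoneOn_div_one_add (fun x : ℝ => (x : ℂ) ^ (u - 1) * (1 - (x : ℂ)) ^ (v - 1))
  have hI := integral_image_eq_integral_deriv_smul_of_monotoneOn measurableSet_Ioi hd
    monotoneOn_div_one_add (fun x : ℝ => (x : ℂ) ^ (u - 1) * (1 - (x : ℂ)) ^ (v - 1))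
  rw [image_div_one_add_Ioi] at hi hI
  constructor
  · refine (hi.1 ?_).congr_fun hc measurableSet_Ioi
    have := betaIntegral_convergent hu hv
    rw [intervalIntegrable_iff_integrableOn_Ioo_of_le zero_le_one] at this
    exact this
  · rw [← setIntegral_congr_fun measurableSet_Ioi hc, ← hI, ← integral_Ioc_eq_integral_Ioo,
      ← intervalIntegral.integral_of_le zero_le_one]
    exact betaIntegral_eq_Gamma_mul_div u v hu hv

theorem one_add_ofReal_ne_zero {t : ℝ} (ht : 0 < t) : (1 + (t : ℂ)) ≠ 0 := by
  have : 1 + t ≠ 0 := by linarith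
  exact_mod_cast this

/-- At index `ν + 1/2` both exponents in Tricomi's integral equal `ν`; this is the form in which an
extra exponential can be absorbed into the Laplace kernel. -/
theorem besselK_eq_laplace (ν : ℝ) (z : ℂ) :
    besselK ((ν : ℂ) + 1 / 2) z = (Real.sqrt Real.pi : ℂ) * (2 * z) ^ ((ν : ℂ) + 1 / 2) *
      cexp (-z) * ((Gamma (ν + 1))⁻¹ *
      ∫ t in Ioi (0 : ℝ), cexp (-(2 * z * t)) * ((t : ℂ) ^ (ν : ℂ) * (1 + (t : ℂ)) ^ (ν : ℂ))) := by
  rw [besselK, tricomiU]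
  have e1 : (ν : ℂ) + 1 / 2 + 1 / 2 = ν + 1 := by ring
  have e2 : 2 * ((ν : ℂ) + 1 / 2) + 1 - (ν + 1) - 1 = ν := by ring
  simp only [e1, e2, add_sub_cancel_right, mul_assoc]

/-- `∫ (1 + t) ^ (-S) (t (1 + t)) ^ ν dt` over the half-line. -/
theorem integral_one_add_cpow_kernel {ν : ℝ} (hν : 0 ≤ ν) {S : ℂ} (hS : 2 * ν + 1 < S.re) :
    IntegrableOn (fun t : ℝ => ((1 + t : ℝ) : ℂ) ^ (-S) *
      ((t : ℂ) ^ (ν : ℂ) * (1 + (t : ℂ)) ^ (ν : ℂ))) (Ioi 0) ∧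
    ∫ t in Ioi (0 : ℝ), ((1 + t : ℝ) : ℂ) ^ (-S) *
      ((t : ℂ) ^ (ν : ℂ) * (1 + (t : ℂ)) ^ (ν : ℂ)) =
      Gamma (ν + 1) * Gamma (S - 2 * ν - 1) / Gamma (S - ν) := by
  have h := beta_integral_Ioi (u := (ν : ℂ) + 1) (v := S - 2 * ν - 1)
    (by simp; linarith) (by simp; linarith)
  have e : (ν : ℂ) + 1 + (S - 2 * ν - 1) = S - ν := by ring
  rw [e] at h
  have hc : ∀ t ∈ Ioi (0 : ℝ), (t : ℂ) ^ ((ν : ℂ) + 1 - 1) * (1 + (t : ℂ)) ^ (-(S - ν)) =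
      ((1 + t : ℝ) : ℂ) ^ (-S) * ((t : ℂ) ^ (ν : ℂ) * (1 + (t : ℂ)) ^ (ν : ℂ)) := by
    intro t ht
    push_cast
    rw [add_sub_cancel_right, neg_sub, sub_eq_add_neg, cpow_add _ _ (one_add_ofReal_ne_zero ht)]
    ring
  exact ⟨h.1.congr_fun hc measurableSet_Ioi, by
    rw [← setIntegral_congr_fun measurableSet_Ioi hc, h.2]⟩

theorem image_quadratic_Ioi : (fun t : ℝ => 4 * (t * (1 + t))) '' Ioi 0 = Ioi 0 := by
  ext x
  constructor
  · rintro ⟨t, ht : 0 < t, rfl⟩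
    simp only [mem_Ioi]
    positivity
  · intro (hx : 0 < x)
    have h1 : 1 < Real.sqrt (1 + x) := by rw [Real.lt_sqrt] <;> linarith
    refine ⟨(Real.sqrt (1 + x) - 1) / 2, by simp only [mem_Ioi]; linarith, ?_⟩
    have := Real.sq_sqrt (show 0 ≤ 1 + x by linarith)
    simp only
    nlinarith

/-- `∫ (1 + 2 t) ^ (-S) (t (1 + t)) ^ ν dt` over the half-line. -/
theorem integral_one_add_two_mul_cpow_kernel {ν : ℝ} (hν : 0 ≤ ν) {S : ℂ}
    (hS : 2 * ν + 1 < S.re) :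
    IntegrableOn (fun t : ℝ => ((1 + 2 * t : ℝ) : ℂ) ^ (-S) *
      ((t : ℂ) ^ (ν : ℂ) * (1 + (t : ℂ)) ^ (ν : ℂ))) (Ioi 0) ∧
    ∫ t in Ioi (0 : ℝ), ((1 + 2 * t : ℝ) : ℂ) ^ (-S) *
      ((t : ℂ) ^ (ν : ℂ) * (1 + (t : ℂ)) ^ (ν : ℂ)) =
      (4 : ℂ) ^ (-(ν : ℂ) - 1) * (Gamma (ν + 1) * Gamma ((S - 2 * ν - 1) / 2) /
        Gamma ((S + 1) / 2)) := by
  have hre : ((S - 2 * ν - 1) / 2).re = (S.re - 2 * ν - 1) / 2 := by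
    rw [show (S - 2 * ν - 1) / 2 = ((1 / 2 : ℝ) : ℂ) * (S - 2 * ν - 1) by push_cast; ring,
      re_ofReal_mul]
    simp; ring
  have h := beta_integral_Ioi (u := (ν : ℂ) + 1) (v := (S - 2 * ν - 1) / 2)
    (by simp; linarith) (by rw [hre]; linarith)
  have e : (ν : ℂ) + 1 + (S - 2 * ν - 1) / 2 = (S + 1) / 2 := by ring
  rw [e] at h
  have hd : ∀ t ∈ Ioi (0 : ℝ), HasDerivWithinAt (fun t : ℝ => 4 * (t * (1 + t)))
      (4 * (1 + 2 * t)) (Ioi 0) t := by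
    intro t _
    have := (((hasDerivAt_id t).mul ((hasDerivAt_id t).const_add 1)).const_mul 4).hasDerivWithinAt
      (s := Ioi 0)
    convert! this using 1
    simp; ring
  have hmono : MonotoneOn (fun t : ℝ => 4 * (t * (1 + t))) (Ioi 0) := by
    intro s (hs : 0 < s) t (ht : 0 < t) hst
    simp only
    gcongr
  have hi := integrableOn_image_iff_integrableOn_deriv_smul_of_monotoneOn measurableSet_Ioi hd
    hmono (fun t : ℝ => (t : ℂ) ^ ((ν : ℂ) + 1 - 1) * (1 + (t : ℂ)) ^ (-((S + 1) / 2)))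
  have hI := integral_image_eq_integral_deriv_smul_of_monotoneOn measurableSet_Ioi hd
    hmono (fun t : ℝ => (t : ℂ) ^ ((ν : ℂ) + 1 - 1) * (1 + (t : ℂ)) ^ (-((S + 1) / 2)))
  rw [image_quadratic_Ioi] at hi hI
  -- With `x = 4t(1+t)` one has `1 + x = (1+2t)^2`. The constant removes `4^ν` from `x^ν` and `4`
  -- from the Jacobian `4(1+2t)`.
  have hc : ∀ t ∈ Ioi (0 : ℝ), (4 : ℂ) ^ (-(ν : ℂ) - 1) * ((4 * (1 + 2 * t)) •
      (((4 * (t * (1 + t)) : ℝ) : ℂ) ^ ((ν : ℂ) + 1 - 1) *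
        (1 + ((4 * (t * (1 + t)) : ℝ) : ℂ)) ^ (-((S + 1) / 2)))) =
      ((1 + 2 * t : ℝ) : ℂ) ^ (-S) * ((t : ℂ) ^ (ν : ℂ) * (1 + (t : ℂ)) ^ (ν : ℂ)) := by
    intro t (ht : 0 < t)
    have h1 : 0 < 1 + 2 * t := by linarith
    have h1c : ((1 + 2 * t : ℝ) : ℂ) ≠ 0 := by exact_mod_cast h1.ne'
    have e1 : (1 + ((4 * (t * (1 + t)) : ℝ) : ℂ)) ^ (-((S + 1) / 2)) =
        ((1 + 2 * t : ℝ) : ℂ) ^ (-S) * ((1 + 2 * t : ℝ) : ℂ)⁻¹ := by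
      rw [show (1 + ((4 * (t * (1 + t)) : ℝ) : ℂ)) = (((1 + 2 * t) ^ 2 : ℝ) : ℂ) by
        push_cast; ring]
      have h2c : (((1 + 2 * t) ^ 2 : ℝ) : ℂ) ≠ 0 := by exact_mod_cast (pow_pos h1 2).ne'
      rw [cpow_def_of_ne_zero h2c, ← ofReal_log (by positivity), Real.log_pow,
        ← cpow_neg_one, ← cpow_add _ _ h1c, cpow_def_of_ne_zero h1c, ← ofReal_log h1.le]
      congr 1
      push_cast
      ring
    have e2 : ((4 * (t * (1 + t)) : ℝ) : ℂ) ^ ((ν : ℂ) + 1 - 1) =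
        (4 : ℂ) ^ (ν : ℂ) * ((t : ℂ) ^ (ν : ℂ) * (1 + (t : ℂ)) ^ (ν : ℂ)) := by
      rw [add_sub_cancel_right, ofReal_mul, mul_cpow_ofReal_nonneg (by norm_num) (by positivity),
        ofReal_mul, mul_cpow_ofReal_nonneg ht.le (by positivity)]
      push_cast
      rfl
    have e3 : (4 : ℂ) ^ (-(ν : ℂ) - 1) * 4 * (4 : ℂ) ^ (ν : ℂ) = 1 := by
      rw [sub_eq_add_neg, cpow_add _ _ (by norm_num), cpow_neg, cpow_neg_one]
      have : (4 : ℂ) ^ (ν : ℂ) ≠ 0 := by simp [cpow_eq_zero_iff]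
      field_simp
    rw [e1, e2, real_smul, ofReal_mul]
    push_cast at h1c ⊢
    calc _ = ((4 : ℂ) ^ (-(ν : ℂ) - 1) * 4 * (4 : ℂ) ^ (ν : ℂ)) *
        ((1 + 2 * (t : ℂ)) * (1 + 2 * (t : ℂ))⁻¹) *
        ((1 + 2 * (t : ℂ)) ^ (-S) * ((t : ℂ) ^ (ν : ℂ) * (1 + (t : ℂ)) ^ (ν : ℂ))) := by ring
      _ = _ := by rw [e3, mul_inv_cancel₀ h1c, one_mul, one_mul]
  constructor
  · exact IntegrableOn.congr_fun (Integrable.const_mul (hi.1 h.1) _) hc measurableSet_Ioi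
  · rw [← setIntegral_congr_fun measurableSet_Ioi hc, integral_const_mul, ← hI, h.2]

theorem cexp_mul_log_eq_cpow {w : ℂ} (hw : w ≠ 0) (s : ℂ) : cexp (s * log w) = w ^ s := by
  rw [cpow_def_of_ne_zero hw, mul_comm]

/-- Mellin–Barnes integral of `e^{-z} K_{ν+1/2}(z)`. -/
theorem integral_barnes_exp_neg_mul_besselK {ν : ℝ} (hν : 0 ≤ ν) {c : ℝ} (hc : ν + 1 / 2 < c)
    {z : ℂ} (hz : 0 < z.re) :
    ∫ y : ℝ, Gamma (c + y * I + (ν + 1 / 2)) * Gamma (c + y * I - (ν + 1 / 2)) /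
        Gamma (c + y * I + 1 / 2) * cexp (-((c + y * I) * log (2 * z))) =
      2 * Real.pi * (cexp (-z) * besselK ((ν : ℂ) + 1 / 2) z / Real.sqrt Real.pi) := by
  set κ : ℝ := ν + 1 / 2 with hκ
  have hκc : ((κ : ℝ) : ℂ) = ν + 1 / 2 := by rw [hκ]; push_cast; ring
  have hz0 : z ≠ 0 := by rintro rfl; simp at hz
  have hz2 : 2 * z ≠ 0 := by simpa using hz0
  have hw : 0 < (2 * z).re := by simp; exact hz
  have hΓ : Gamma ((ν : ℂ) + 1) ≠ 0 := Gamma_ne_zero_of_re_pos (by simp; linarith)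
  have hπ : (Real.sqrt Real.pi : ℂ) ≠ 0 := by
    exact_mod_cast (Real.sqrt_pos.2 Real.pi_pos).ne'
  -- `e^(-2z) e^(-2zt)` gives `q = 1 + t`. The line is shifted by `κ` because of the prefactor
  -- `(2z)^κ`, and the beta condition `2ν + 1 < c + κ` becomes `ν + 1/2 < c`.
  have h := integral_Gamma_mul_integral_cpow (σ := c + κ) (by linarith) hw
    (q := fun t => 1 + t) (by fun_prop) (fun t ht => by linarith)
    (integral_one_add_cpow_kernel hν (S := ((c + κ : ℝ) : ℂ)) (by
      rw [ofReal_re]; linarith)).1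
  have hL : ∀ y : ℝ, Gamma ((c : ℂ) + y * I + (ν + 1 / 2)) * Gamma (c + y * I - (ν + 1 / 2)) /
        Gamma (c + y * I + 1 / 2) * cexp (-((c + y * I) * log (2 * z))) =
      (Gamma ((ν : ℂ) + 1))⁻¹ * (2 * z) ^ ((ν : ℂ) + 1 / 2) *
      (Gamma ((c + κ : ℝ) + y * I) * cexp (-(((c + κ : ℝ) + y * I) * log (2 * z))) *
        ∫ t in Ioi (0 : ℝ), ((1 + t : ℝ) : ℂ) ^ (-(((c + κ : ℝ) : ℂ) + y * I)) *
          ((t : ℂ) ^ (ν : ℂ) * (1 + (t : ℂ)) ^ (ν : ℂ))) := by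
    intro y
    rw [(integral_one_add_cpow_kernel hν (S := ((c + κ : ℝ) : ℂ) + y * I) (by
      rw [add_re, ofReal_re, re_ofReal_mul, I_re]; linarith)).2]
    have e1 : ((c + κ : ℝ) : ℂ) + y * I = c + y * I + (ν + 1 / 2) := by
      rw [ofReal_add, hκc]; ring
    have e2 : (c : ℂ) + y * I + (ν + 1 / 2) - 2 * ν - 1 = c + y * I - (ν + 1 / 2) := by ring
    have e3 : (c : ℂ) + y * I + (ν + 1 / 2) - ν = c + y * I + 1 / 2 := by ring
    rw [e1, e2, e3, ← cexp_mul_log_eq_cpow hz2]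
    have e4 : cexp (-((c + y * I) * log (2 * z))) = cexp (((ν : ℂ) + 1 / 2) * log (2 * z)) *
        cexp (-((c + y * I + (ν + 1 / 2)) * log (2 * z))) := by
      rw [← Complex.exp_add]; congr 1; ring
    rw [e4]
    field_simp
  simp_rw [hL]
  rw [integral_const_mul, h, besselK_eq_laplace]
  have e5 : ∫ t in Ioi (0 : ℝ), cexp (-(2 * z * ((1 + t : ℝ) : ℂ))) *
      ((t : ℂ) ^ (ν : ℂ) * (1 + (t : ℂ)) ^ (ν : ℂ)) = cexp (-z) * cexp (-z) *
      ∫ t in Ioi (0 : ℝ), cexp (-(2 * z * t)) *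
        ((t : ℂ) ^ (ν : ℂ) * (1 + (t : ℂ)) ^ (ν : ℂ)) := by
    rw [← integral_const_mul]
    congr 1 with t
    rw [show -(2 * z * ((1 + t : ℝ) : ℂ)) = -z + -z + -(2 * z * t) by push_cast; ring,
      Complex.exp_add, Complex.exp_add]
    ring
  rw [e5]
  field_simp

/-- Mellin–Barnes integral of `K_{ν+1/2}(z)`. -/
theorem integral_barnes_besselK {ν : ℝ} (hν : 0 ≤ ν) {c : ℝ} (hc : ν + 1 / 2 < c)
    {z : ℂ} (hz : 0 < z.re) :
    ∫ y : ℝ, Gamma ((c + y * I + (ν + 1 / 2)) / 2) * Gamma ((c + y * I - (ν + 1 / 2)) / 2) *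
        cexp (-((c + y * I) * log (z / 2))) =
      2 * Real.pi * (4 * besselK ((ν : ℂ) + 1 / 2) z) := by
  set κ : ℝ := ν + 1 / 2 with hκ
  have hκc : ((κ : ℝ) : ℂ) = ν + 1 / 2 := by rw [hκ]; push_cast; ring
  have hz0 : z ≠ 0 := by rintro rfl; simp at hz
  have hΓ : Gamma ((ν : ℂ) + 1) ≠ 0 := Gamma_ne_zero_of_re_pos (by simp; linarith)
  have hπ : (Real.sqrt Real.pi : ℂ) ≠ 0 := by
    exact_mod_cast (Real.sqrt_pos.2 Real.pi_pos).ne'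
  have h2 : (2 : ℂ) ≠ 0 := two_ne_zero
  have hlogz : log (z / 2) = log z - log 2 := by
    have := log_mul_ofReal (1 / 2) (by norm_num) z hz0
    rw [show z / 2 = z * ((1 / 2 : ℝ) : ℂ) by push_cast; ring, this]
    rw [Real.log_div one_ne_zero two_ne_zero, Real.log_one, zero_sub, ofReal_neg,
      ofReal_log (by norm_num)]
    push_cast; ring
  have hlog2 : log (2 * z) = log 2 + log z := by
    have := log_ofReal_mul (r := 2) (by norm_num) hz0
    rwa [ofReal_log (by norm_num), ofReal_ofNat] at this
  have hlog4 : log 4 = 2 * log 2 := by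
    have h4 : Real.log 4 = 2 * Real.log 2 := by
      rw [show (4 : ℝ) = 2 ^ 2 by norm_num, Real.log_pow]; norm_num
    have := congrArg (fun r : ℝ => (r : ℂ)) h4
    simpa [ofReal_log] using this
  -- Without an extra exponential, `e^(-z) e^(-2zt)` gives `q = 1 + 2t` with rate `z`.
  have h := integral_Gamma_mul_integral_cpow (σ := c + κ) (by linarith) hz
    (q := fun t => 1 + 2 * t) (by fun_prop) (fun t ht => by linarith)
    (integral_one_add_two_mul_cpow_kernel hν (S := ((c + κ : ℝ) : ℂ)) (by
      rw [ofReal_re]; linarith)).1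
  have hL : ∀ y : ℝ, Gamma (((c : ℂ) + y * I + (ν + 1 / 2)) / 2) *
        Gamma ((c + y * I - (ν + 1 / 2)) / 2) * cexp (-((c + y * I) * log (z / 2))) =
      4 * Real.sqrt Real.pi * (Gamma ((ν : ℂ) + 1))⁻¹ * (2 * z) ^ ((ν : ℂ) + 1 / 2) *
      (Gamma ((c + κ : ℝ) + y * I) * cexp (-(((c + κ : ℝ) + y * I) * log z)) *
        ∫ t in Ioi (0 : ℝ), ((1 + 2 * t : ℝ) : ℂ) ^ (-(((c + κ : ℝ) : ℂ) + y * I)) *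
          ((t : ℂ) ^ (ν : ℂ) * (1 + (t : ℂ)) ^ (ν : ℂ))) := by
    intro y
    rw [(integral_one_add_two_mul_cpow_kernel hν (S := ((c + κ : ℝ) : ℂ) + y * I) (by
      rw [add_re, ofReal_re, re_ofReal_mul, I_re]; linarith)).2]
    have e1 : ((c + κ : ℝ) : ℂ) + y * I = c + y * I + (ν + 1 / 2) := by
      rw [ofReal_add, hκc]; ring
    rw [e1]
    set S : ℂ := c + y * I + (ν + 1 / 2) with hS
    have hSre : (S / 2 + 1 / 2).re = (c + κ) / 2 + 1 / 2 := by
      rw [← e1, show (((c + κ : ℝ) : ℂ) + y * I) / 2 + 1 / 2 =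
        (((c + κ) / 2 + 1 / 2 : ℝ) : ℂ) + ((y / 2 : ℝ) : ℂ) * I by push_cast; ring,
        add_re, ofReal_re, re_ofReal_mul, I_re]
      ring
    have hS2 : Gamma (S / 2 + 1 / 2) ≠ 0 :=
      Gamma_ne_zero_of_re_pos (by rw [hSre]; linarith)
    have e2 : (c : ℂ) + y * I - (ν + 1 / 2) = S - 2 * ν - 1 := by rw [hS]; ring
    have e3 : (c : ℂ) + y * I = S - (ν + 1 / 2) := by rw [hS]; ring
    -- Duplication of `Γ(S)` cancels the denominator `Γ((S+1)/2)` of the beta integral and leaves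
    -- `Γ(S/2)`.
    have hdup := Gamma_mul_Gamma_add_half (S / 2)
    rw [show 2 * (S / 2) = S by ring] at hdup
    rw [e2, e3, show (S + 1) / 2 = S / 2 + 1 / 2 by ring]
    have hG : Gamma (S / 2) = Gamma S * 2 ^ (1 - S) * Real.sqrt Real.pi / Gamma (S / 2 + 1 / 2) := by
      rw [eq_div_iff hS2, hdup]
    have hpow : cexp (-((S - (ν + 1 / 2)) * log (z / 2))) * 2 ^ (1 - S) =
        4 * (2 * z) ^ ((ν : ℂ) + 1 / 2) * cexp (-(S * log z)) * (4 : ℂ) ^ (-(ν : ℂ) - 1) := by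
      have h4 : (4 : ℂ) = cexp (2 * log 2) := by
        rw [← hlog4, exp_log (by norm_num)]
      rw [cpow_def_of_ne_zero h2, cpow_def_of_ne_zero (by simpa using hz0),
        cpow_def_of_ne_zero (by norm_num : (4 : ℂ) ≠ 0), hlogz, hlog2, hlog4]
      nth_rewrite 1 [h4]
      rw [← Complex.exp_add, ← Complex.exp_add, ← Complex.exp_add, ← Complex.exp_add]
      congr 1
      ring
    rw [hG]
    calc _ = (cexp (-((S - (ν + 1 / 2)) * log (z / 2))) * 2 ^ (1 - S)) *
          (Gamma S * Real.sqrt Real.pi / Gamma (S / 2 + 1 / 2) * Gamma ((S - 2 * ν - 1) / 2)) := by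
          ring
      _ = _ := by
        rw [hpow]
        field_simp
  simp_rw [hL]
  rw [integral_const_mul, h, besselK_eq_laplace]
  have e5 : ∫ t in Ioi (0 : ℝ), cexp (-(z * ((1 + 2 * t : ℝ) : ℂ))) *
      ((t : ℂ) ^ (ν : ℂ) * (1 + (t : ℂ)) ^ (ν : ℂ)) = cexp (-z) *
      ∫ t in Ioi (0 : ℝ), cexp (-(2 * z * t)) *
        ((t : ℂ) ^ (ν : ℂ) * (1 + (t : ℂ)) ^ (ν : ℂ)) := by
    rw [← integral_const_mul]
    congr 1 with t
    rw [show -(z * ((1 + 2 * t : ℝ) : ℂ)) = -z + -(2 * z * t) by push_cast; ring,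
      Complex.exp_add]
    ring
  rw [e5]
  ring

end BesselMellinBarnes

/-! ### Mellin transform of the binomial remainder. -/

section BinomialRemainder
open Complex MeasureTheory Set Filter Topology

/-- The real binomial coefficient `ν (ν - 1) ⋯ (ν - k + 1) / k!`. -/
noncomputable def binomialCoeff (ν : ℝ) (k : ℕ) : ℝ :=
  (∏ i ∈ Finset.range k, (ν - i)) / k.factorial

theorem binomialCoeff_zero (ν : ℝ) : binomialCoeff ν 0 = 1 := by simp [binomialCoeff]

theorem binomialCoeff_succ_mul (ν : ℝ) (k : ℕ) :
    binomialCoeff ν (k + 1) * (k + 1) = ν * binomialCoeff (ν - 1) k := by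
  have : (k.factorial : ℝ) ≠ 0 := by positivity
  rw [binomialCoeff, binomialCoeff, Finset.prod_range_succ', Nat.factorial_succ]
  have : ∀ i : ℕ, ν - ((i + 1 : ℕ) : ℝ) = ν - 1 - i := fun i => by push_cast; ring
  simp only [this]
  push_cast
  field_simp
  simp only [sub_zero]
  ring

theorem binomialCoeff_eq_Gamma {ν : ℝ} (hν : ∀ k : ℕ, ν ≠ k) (k : ℕ) :
    (binomialCoeff ν k : ℂ) =
      (-1) ^ k * Gamma (k - ν) / (Gamma (-(ν : ℂ)) * k.factorial) := by
  have hn : ∀ m : ℕ, (m : ℂ) - ν ≠ 0 := fun m h => hν m (by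
    have := sub_eq_zero.1 h
    exact_mod_cast this.symm)
  have hΓ : Gamma (-(ν : ℂ)) ≠ 0 := Gamma_ne_zero fun m h => hν m (by
    have := neg_inj.1 h
    exact_mod_cast this)
  have hf : (k.factorial : ℂ) ≠ 0 := by exact_mod_cast k.factorial_ne_zero
  rw [binomialCoeff, ofReal_div, ofReal_natCast, div_eq_div_iff hf (mul_ne_zero hΓ hf)]
  suffices ((∏ i ∈ Finset.range k, (ν - i) : ℝ) : ℂ) * Gamma (-(ν : ℂ)) =
      (-1) ^ k * Gamma (k - ν) by
    rw [← mul_assoc, this]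
  clear hf
  induction k with
  | zero => simp
  | succ k ih =>
    rw [Finset.prod_range_succ, ofReal_mul, mul_right_comm, ih,
      show ((k + 1 : ℕ) : ℂ) - ν = (k - ν) + 1 by push_cast; ring, Gamma_add_one _ (hn k)]
    push_cast
    ring

/-- The remainder of the binomial expansion of `(1 + t) ^ ν` after `N` terms. -/
noncomputable def binomialRemainder (ν : ℝ) (N : ℕ) (t : ℝ) : ℝ :=
  (1 + t) ^ ν - ∑ k ∈ Finset.range N, binomialCoeff ν k * t ^ k

theorem measurable_binomialRemainder (ν : ℝ) (N : ℕ) : Measurable (binomialRemainder ν N) := by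
  unfold binomialRemainder
  fun_prop

theorem continuousOn_binomialRemainder (ν : ℝ) (N : ℕ) :
    ContinuousOn (binomialRemainder ν N) (Ici 0) := by
  unfold binomialRemainder
  refine ContinuousOn.sub ?_ (by fun_prop)
  refine ContinuousOn.rpow_const (by fun_prop) fun t (ht : 0 ≤ t) => Or.inl ?_
  positivity

/-- Differentiation lowers the exponent and the number of subtracted terms together; the induction
on `N` rests on this. -/
theorem hasDerivAt_binomialRemainder (ν : ℝ) (N : ℕ) {t : ℝ} (ht : 0 ≤ t) :
    HasDerivAt (binomialRemainder ν (N + 1)) (ν * binomialRemainder (ν - 1) N t) t := by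
  have h1 : HasDerivAt (fun t : ℝ => (1 + t) ^ ν) (ν * (1 + t) ^ (ν - 1)) t := by
    have := ((hasDerivAt_id t).const_add 1).rpow_const (p := ν)
      (Or.inl (by simp; positivity))
    simpa using this
  have h2 : HasDerivAt (fun t : ℝ => ∑ k ∈ Finset.range (N + 1), binomialCoeff ν k * t ^ k)
      (∑ k ∈ Finset.range (N + 1), binomialCoeff ν k * (k * t ^ (k - 1))) t :=
    HasDerivAt.fun_sum fun k _ => (hasDerivAt_pow k t).const_mul _
  convert! h1.sub h2 using 1
  rw [binomialRemainder, mul_sub, Finset.sum_range_succ', Finset.mul_sum]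
  simp only [Nat.cast_zero, zero_mul, mul_zero, add_zero, Nat.add_sub_cancel]
  congr 1
  refine Finset.sum_congr rfl fun k _ => ?_
  rw [← mul_assoc, ← mul_assoc, ← binomialCoeff_succ_mul]
  push_cast
  ring

theorem binomialRemainder_succ_zero (ν : ℝ) (N : ℕ) : binomialRemainder ν (N + 1) 0 = 0 := by
  rw [binomialRemainder, Finset.sum_range_succ']
  simp [binomialCoeff_zero]

/-- The remainder vanishes at `0`, hence is the integral of its derivative. Parametrising by `u ∈
[0, 1]` makes the integrand a dilate, which a Mellin transform turns into a power of `u`. -/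
theorem binomialRemainder_succ_eq_integral (ν : ℝ) (N : ℕ) {t : ℝ} (ht : 0 < t) :
    binomialRemainder ν (N + 1) t =
      ν * t * ∫ u in (0 : ℝ)..1, binomialRemainder (ν - 1) N (u * t) := by
  have hd : ∀ u ∈ uIcc (0 : ℝ) 1, HasDerivAt (fun u => binomialRemainder ν (N + 1) (u * t))
      (ν * t * binomialRemainder (ν - 1) N (u * t)) u := by
    intro u hu
    rw [uIcc_of_le zero_le_one] at hu
    have h := (hasDerivAt_binomialRemainder ν N (t := u * t) (by have := hu.1; positivity)).comp u
      ((hasDerivAt_id u).mul_const t)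
    convert! h using 1
    ring
  have hc : ContinuousOn (fun u => ν * t * binomialRemainder (ν - 1) N (u * t))
      (uIcc (0 : ℝ) 1) := by
    refine continuousOn_const.mul ((continuousOn_binomialRemainder _ _).comp (by fun_prop) ?_)
    intro u hu
    rw [uIcc_of_le zero_le_one] at hu
    exact mul_nonneg hu.1 ht.le
  have := intervalIntegral.integral_eq_sub_of_hasDerivAt hd hc.intervalIntegrable
  rw [intervalIntegral.integral_const_mul] at this
  rw [this]
  simp [binomialRemainder_succ_zero]

/-- Mellin transform of the remainder of the binomial expansion. -/
theorem mellin_binomialRemainder (N : ℕ) : ∀ (ν : ℝ) (a : ℂ), -(N : ℝ) < a.re →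
    (N = 0 ∨ a.re < 1 - N) → a.re + ν < 0 →
    IntegrableOn (fun t : ℝ => (t : ℂ) ^ (a - 1) * (binomialRemainder ν N t : ℂ)) (Ioi 0) ∧
    ∫ t in Ioi (0 : ℝ), (t : ℂ) ^ (a - 1) * (binomialRemainder ν N t : ℂ) =
      Gamma a * Gamma (-ν - a) * (Gamma (-(ν : ℂ)))⁻¹ := by
  induction N with
  | zero =>
    intro ν a h1 _ h3
    have h := beta_integral_Ioi (u := a) (v := -ν - a) (by simpa using h1) (by simp; linarith)
    have hc : ∀ t ∈ Ioi (0 : ℝ), (t : ℂ) ^ (a - 1) * (1 + (t : ℂ)) ^ (-(a + (-ν - a))) =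
        (t : ℂ) ^ (a - 1) * (binomialRemainder ν 0 t : ℂ) := by
      intro t (ht : 0 < t)
      rw [binomialRemainder, Finset.sum_range_zero, sub_zero, ofReal_cpow (by positivity)]
      push_cast
      ring_nf
    refine ⟨h.1.congr_fun hc measurableSet_Ioi, ?_⟩
    rw [← setIntegral_congr_fun measurableSet_Ioi hc, h.2, div_eq_mul_inv]
    ring_nf
  | succ N ih =>
    intro ν a h1 h2 h3
    have ha : a.re < -N := by
      rcases h2 with h2 | h2
      · omega
      · push_cast at h2; linarith
    have ha0 : a.re < 0 := ha.trans_le (by simp)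
    have hane : a ≠ 0 := by rintro rfl; simp at ha0
    push_cast at h1
    -- Passing to `(ν - 1, a + 1)` moves the strip for `N + 1` to that for `N` and leaves `Re a + ν`
    -- unchanged.
    obtain ⟨hG, hGI⟩ := ih (ν - 1) (a + 1) (by simp; linarith)
      (Or.inr (by simp; linarith)) (by simp; linarith)
    rw [add_sub_cancel_right] at hG hGI
    set G : ℝ → ℂ := fun t => (t : ℂ) ^ a * (binomialRemainder (ν - 1) N t : ℂ) with hGdef
    have hscale : ∀ u t : ℝ, 0 < u → 0 < t →
        (t : ℂ) ^ a * (binomialRemainder (ν - 1) N (u * t) : ℂ) = (u : ℂ) ^ (-a) * G (u * t) := by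
      intro u t hu ht
      have : (u : ℂ) ^ a ≠ 0 := by simp [cpow_eq_zero_iff, hu.ne']
      rw [hGdef]
      simp only
      rw [ofReal_mul, mul_cpow_ofReal_nonneg hu.le ht.le, cpow_neg]
      field_simp
    have hint1 : ∀ u : ℝ, 0 < u → IntegrableOn (fun t => G (u * t)) (Ioi 0) := fun u hu => by
      have := (integrableOn_Ioi_comp_mul_left_iff G 0 hu).2
      rw [mul_zero] at this
      exact this hG
    have hint : Integrable (Function.uncurry fun (u t : ℝ) =>
        (t : ℂ) ^ a * (binomialRemainder (ν - 1) N (u * t) : ℂ))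
        ((volume.restrict (Ioc 0 1)).prod (volume.restrict (Ioi 0))) := by
      have hm := measurable_binomialRemainder (ν - 1) N
      refine (integrable_prod_iff (Measurable.aestronglyMeasurable
        (by unfold Function.uncurry; fun_prop))).2 ⟨?_, ?_⟩
      · filter_upwards [ae_restrict_mem measurableSet_Ioc] with u hu
        exact IntegrableOn.congr_fun (Integrable.const_mul (hint1 u hu.1) ((u : ℂ) ^ (-a)))
          (fun t ht => (hscale u t hu.1 ht).symm) measurableSet_Ioi
      -- By scaling, the inner norm integral is a multiple of `u^(-Re a - 1)`, integrable at `0`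
      -- because `Re a < 0`.
      · have hI : IntegrableOn (fun u : ℝ => u ^ (-a.re - 1) * ∫ t in Ioi (0 : ℝ), ‖G t‖)
            (Ioc 0 1) := by
          have := intervalIntegral.intervalIntegrable_rpow' (a := 0) (b := 1)
            (r := -a.re - 1) (by linarith)
          rw [intervalIntegrable_iff_integrableOn_Ioc_of_le zero_le_one] at this
          exact this.mul_const _
        refine IntegrableOn.congr_fun hI (fun u hu => ?_) measurableSet_Ioc
        have hu0 : 0 < u := hu.1
        simp only [Function.uncurry]
        have hn : ∀ t ∈ Ioi (0 : ℝ), ‖(t : ℂ) ^ a * (binomialRemainder (ν - 1) N (u * t) : ℂ)‖ =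
            u ^ (-a.re) * ‖G (u * t)‖ := fun t ht => by
          rw [hscale u t hu.1 ht, norm_mul, norm_cpow_eq_rpow_re_of_pos hu.1, neg_re]
        rw [setIntegral_congr_fun measurableSet_Ioi hn, integral_const_mul, integral_comp_mul_left_Ioi (fun t => ‖G t‖) 0 hu.1, mul_zero,
          Real.rpow_sub_one hu0.ne', smul_eq_mul]
        ring
    have hrec : ∀ t ∈ Ioi (0 : ℝ), ν * ∫ u in Ioc (0 : ℝ) 1,
        (t : ℂ) ^ a * (binomialRemainder (ν - 1) N (u * t) : ℂ) =
        (t : ℂ) ^ (a - 1) * (binomialRemainder ν (N + 1) t : ℂ) := by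
      intro t (ht : 0 < t)
      have ht0 : (t : ℂ) ≠ 0 := by exact_mod_cast ht.ne'
      rw [binomialRemainder_succ_eq_integral ν N ht, integral_const_mul,
        ← intervalIntegral.integral_of_le zero_le_one, intervalIntegral.integral_ofReal,
        cpow_sub _ _ ht0, cpow_one]
      generalize (∫ u in (0 : ℝ)..1, binomialRemainder (ν - 1) N (u * t)) = J
      push_cast
      field_simp
    constructor
    · exact IntegrableOn.congr_fun (Integrable.const_mul hint.integral_prod_right _) hrec
        measurableSet_Ioi
    · rw [← setIntegral_congr_fun measurableSet_Ioi hrec, integral_const_mul,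
        ← integral_integral_swap hint]
      have hin : ∀ u ∈ Ioc (0 : ℝ) 1, ∫ t in Ioi (0 : ℝ),
          (t : ℂ) ^ a * (binomialRemainder (ν - 1) N (u * t) : ℂ) =
          (u : ℂ) ^ (-a - 1) * ∫ t in Ioi (0 : ℝ), G t := by
        intro u hu
        have hu0 : (u : ℂ) ≠ 0 := by exact_mod_cast hu.1.ne'
        rw [setIntegral_congr_fun measurableSet_Ioi (fun t ht => hscale u t hu.1 ht),
          integral_const_mul, integral_comp_mul_left_Ioi G 0 hu.1, mul_zero,
          cpow_sub _ _ hu0, cpow_one, real_smul]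
        push_cast
        ring
      rw [setIntegral_congr_fun measurableSet_Ioc hin, integral_mul_const,
        ← intervalIntegral.integral_of_le zero_le_one,
        integral_cpow (Or.inl (by simp; linarith)), hGI]
      have e1 : -((ν - 1 : ℝ) : ℂ) - (a + 1) = -ν - a := by push_cast; ring
      have e2 : -((ν - 1 : ℝ) : ℂ) = -ν + 1 := by push_cast; ring
      -- The `u`-integral is `-1/a`; it combines with `Γ(a+1) = a Γ(a)` and this recurrence, which
      -- holds also at the poles of `Γ` since `1/Γ` is entire.
      have hrecip := one_div_Gamma_eq_self_mul_one_div_Gamma_add_one (-(ν : ℂ))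
      rw [e1, e2, hrecip, Gamma_add_one a hane]
      simp only [sub_add_cancel, ofReal_one, one_cpow, ofReal_zero,
        zero_cpow (neg_ne_zero.2 hane)]
      field_simp
      ring

end BinomialRemainder

/-! ### The Mellin–Barnes integral of `e^z K`; contour and residues in the definition of `G`. -/

section MeijerValues
open Complex MeasureTheory Set Filter Topology

theorem integrableOn_laplace_kernel {ν : ℝ} (hν : 0 ≤ ν) {w : ℂ} (hw : 0 < w.re) :
    IntegrableOn (fun t : ℝ => cexp (-(w * t)) * ((t : ℂ) ^ (ν : ℂ) * (1 + (t : ℂ)) ^ (ν : ℂ)))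
      (Ioi 0) := by
  have h1 := integrableOn_rpow_mul_exp_neg_mul_rpow (s := ν) (p := 1) (by linarith) one_pos hw
  have h2 := integrableOn_rpow_mul_exp_neg_mul_rpow (s := ν + ν) (p := 1) (by linarith) one_pos hw
  refine Integrable.mono' ((h1.add h2).const_mul (2 ^ ν)) ?_ ?_
  · exact (by fun_prop : Measurable fun t : ℝ =>
      cexp (-(w * t)) * ((t : ℂ) ^ (ν : ℂ) * (1 + (t : ℂ)) ^ (ν : ℂ))).aestronglyMeasurable
  · filter_upwards [ae_restrict_mem measurableSet_Ioi] with t (ht : 0 < t)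
    have e1 : ‖(1 + (t : ℂ)) ^ (ν : ℂ)‖ = (1 + t) ^ ν := by
      rw [← ofReal_one, ← ofReal_add, norm_cpow_eq_rpow_re_of_pos (by positivity), ofReal_re]
    have e2 : (1 + t) ^ ν ≤ 2 ^ ν * (1 + t ^ ν) := by
      have h3 : (1 + t) ^ ν ≤ (2 * max 1 t) ^ ν := by
        apply Real.rpow_le_rpow (by positivity) _ hν
        have := le_max_left 1 t
        have := le_max_right 1 t
        linarith
      rw [Real.mul_rpow (by norm_num) (by positivity)] at h3
      refine h3.trans ?_
      gcongr
      rcases max_cases 1 t with ⟨h, _⟩ | ⟨h, _⟩ <;> rw [h]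
      · rw [Real.one_rpow]; linarith [Real.rpow_nonneg ht.le ν]
      · linarith
    rw [norm_mul, norm_mul, e1, norm_cpow_eq_rpow_re_of_pos ht, ofReal_re, norm_exp]
    have e3 : (-(w * t)).re = -w.re * t ^ (1 : ℝ) := by simp
    rw [e3]
    simp only [Pi.add_apply]
    calc Real.exp (-w.re * t ^ (1 : ℝ)) * (t ^ ν * (1 + t) ^ ν)
        ≤ Real.exp (-w.re * t ^ (1 : ℝ)) * (t ^ ν * (2 ^ ν * (1 + t ^ ν))) := by gcongr
      _ = _ := by rw [Real.rpow_add ht]; ring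

/-- Mellin–Barnes integral of `e^z K_{ν+1/2}(z)`, minus the first terms of its asymptotic
expansion at infinity. -/
theorem integral_barnes_exp_mul_besselK {ν : ℝ} (hν : 0 ≤ ν) (hν' : ∀ k : ℕ, ν ≠ k) {c : ℝ}
    (hc : ν + 1 / 2 < c) {N : ℕ} (hN : (N : ℝ) - 1 / 2 < c) (hN' : c < N + 1 / 2)
    {z : ℂ} (hz : 0 < z.re) :
    ∫ y : ℝ, Gamma (c + y * I + (ν + 1 / 2)) * Gamma (c + y * I - (ν + 1 / 2)) *
        Gamma (1 / 2 - (c + y * I)) * cexp (-((c + y * I) * log (2 * z))) =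
      2 * Real.pi * (Real.sqrt Real.pi / cos (Real.pi * ((ν : ℂ) + 1 / 2)) *
        (cexp z * besselK ((ν : ℂ) + 1 / 2) z) -
        ∑ k ∈ Finset.range N, Gamma (ν + 1 + k) * Gamma (k - ν) * ((-1) ^ k / k.factorial) *
          cexp (-((1 / 2 + k) * log (2 * z)))) := by
  set κ : ℝ := ν + 1 / 2 with hκ
  have hκc : ((κ : ℝ) : ℂ) = ν + 1 / 2 := by rw [hκ]; push_cast; ring
  have hz0 : z ≠ 0 := by rintro rfl; simp at hz
  have hz2 : 2 * z ≠ 0 := by simpa using hz0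
  have hw : 0 < (2 * z).re := by simp; exact hz
  have hΓ : Gamma ((ν : ℂ) + 1) ≠ 0 := Gamma_ne_zero_of_re_pos (by simp; linarith)
  have hΓ' : Gamma (-(ν : ℂ)) ≠ 0 := Gamma_ne_zero fun m h => hν' m (by
    have := neg_inj.1 h
    exact_mod_cast this)
  have hπ : (Real.sqrt Real.pi : ℂ) ≠ 0 := by
    exact_mod_cast (Real.sqrt_pos.2 Real.pi_pos).ne'
  have hππ : (Real.sqrt Real.pi : ℂ) * Real.sqrt Real.pi = Real.pi := by
    rw [← ofReal_mul, Real.mul_self_sqrt Real.pi_pos.le]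
  -- The reflection formula is the source of the cosine in representations (2) and (4).
  have hrefl : Gamma (-(ν : ℂ)) * Gamma (ν + 1) =
      Real.pi / cos (Real.pi * ((ν : ℂ) + 1 / 2)) := by
    have := Gamma_mul_Gamma_one_sub (-(ν : ℂ))
    rw [sub_neg_eq_add, add_comm 1] at this
    rw [this]
    congr 1
    rw [show (Real.pi : ℂ) * ((ν : ℂ) + 1 / 2) = Real.pi / 2 - Real.pi * -(ν : ℂ) by ring,
      cos_pi_div_two_sub]
  have hker : ∀ (S : ℂ), ∀ t ∈ Ioi (0 : ℝ),
      (t : ℂ) ^ (ν + 1 - S - 1) * (binomialRemainder ν N t : ℂ) =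
      (t : ℂ) ^ (-S) * ((t : ℂ) ^ (ν : ℂ) * (binomialRemainder ν N t : ℂ)) := by
    intro S t (ht : 0 < t)
    rw [← mul_assoc, ← cpow_add _ _ (by exact_mod_cast ht.ne')]
    congr 2
    ring
  -- Here `q = t`, and `t^(-S) (t(1+t))^ν` is not integrable at `0` on this line, so the remainder
  -- replaces `(1+t)^ν`. With `Re a = 1/2 - c`, the strip of the Mellin formula is `N - 1/2 < c < N
  -- + 1/2`.
  have hM : ∀ y : ℝ, _ := fun y : ℝ => mellin_binomialRemainder N ν
    (ν + 1 - (((c + κ : ℝ) : ℂ) + y * I)) (by simp; linarith) (Or.inr (by simp; linarith))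
    (by simp; linarith)
  have h := integral_Gamma_mul_integral_cpow (σ := c + κ) (by linarith) hw
    (q := fun t => t) (by fun_prop) (fun t ht => ht)
    (g := fun t => (t : ℂ) ^ (ν : ℂ) * (binomialRemainder ν N t : ℂ)) (by
      have := ((hM 0).1).congr_fun (hker _) measurableSet_Ioi
      simpa using this)
  have hL : ∀ y : ℝ, Gamma ((c : ℂ) + y * I + (ν + 1 / 2)) * Gamma (c + y * I - (ν + 1 / 2)) *
        Gamma (1 / 2 - (c + y * I)) * cexp (-((c + y * I) * log (2 * z))) =
      Gamma (-(ν : ℂ)) * (2 * z) ^ ((ν : ℂ) + 1 / 2) *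
      (Gamma ((c + κ : ℝ) + y * I) * cexp (-(((c + κ : ℝ) + y * I) * log (2 * z))) *
        ∫ t in Ioi (0 : ℝ), (t : ℂ) ^ (-(((c + κ : ℝ) : ℂ) + y * I)) *
          ((t : ℂ) ^ (ν : ℂ) * (binomialRemainder ν N t : ℂ))) := by
    intro y
    rw [← setIntegral_congr_fun measurableSet_Ioi (hker _), (hM y).2]
    have e1 : ((c + κ : ℝ) : ℂ) + y * I = c + y * I + (ν + 1 / 2) := by
      rw [ofReal_add, hκc]; ring
    have e2 : (ν : ℂ) + 1 - (c + y * I + (ν + 1 / 2)) = 1 / 2 - (c + y * I) := by ring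
    have e3 : -(ν : ℂ) - (1 / 2 - (c + y * I)) = c + y * I - (ν + 1 / 2) := by ring
    rw [e1, e2, e3, ← cexp_mul_log_eq_cpow hz2]
    have e4 : cexp (-((c + y * I) * log (2 * z))) = cexp (((ν : ℂ) + 1 / 2) * log (2 * z)) *
        cexp (-((c + y * I + (ν + 1 / 2)) * log (2 * z))) := by
      rw [← Complex.exp_add]; congr 1; ring
    rw [e4]
    field_simp
  simp_rw [hL]
  rw [integral_const_mul, h]
  have hmono : ∀ k : ℕ, IntegrableOn (fun t : ℝ => (binomialCoeff ν k : ℂ) *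
      ((t : ℂ) ^ ((ν : ℂ) + 1 + k - 1) * cexp (-(2 * z * t)))) (Ioi 0) ∧
      ∫ t in Ioi (0 : ℝ), (binomialCoeff ν k : ℂ) *
      ((t : ℂ) ^ ((ν : ℂ) + 1 + k - 1) * cexp (-(2 * z * t))) =
      (binomialCoeff ν k : ℂ) * ((2 * z) ^ (-((ν : ℂ) + 1 + k)) * Gamma (ν + 1 + k)) := by
    intro k
    have hre : 0 < ((ν : ℂ) + 1 + k).re := by simp; positivity
    refine ⟨Integrable.const_mul (integrableOn_cpow_mul_exp_neg hre hw) _, ?_⟩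
    rw [integral_const_mul, integral_cpow_mul_exp_neg_of_re_pos hre hw]
  -- Each subtracted monomial `t^(ν+k)` has an elementary Laplace transform; together they form the
  -- finite sum in the result.
  have hsplit : ∫ t in Ioi (0 : ℝ), cexp (-(2 * z * t)) *
      ((t : ℂ) ^ (ν : ℂ) * (binomialRemainder ν N t : ℂ)) =
      (∫ t in Ioi (0 : ℝ), cexp (-(2 * z * t)) *
        ((t : ℂ) ^ (ν : ℂ) * (1 + (t : ℂ)) ^ (ν : ℂ))) -
      ∑ k ∈ Finset.range N,
        (binomialCoeff ν k : ℂ) * ((2 * z) ^ (-((ν : ℂ) + 1 + k)) * Gamma (ν + 1 + k)) := by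
    rw [← Finset.sum_congr rfl fun k _ => (hmono k).2,
      ← integral_finsetSum _ fun k _ => (hmono k).1,
      ← integral_sub (integrableOn_laplace_kernel hν hw)
        (integrable_finsetSum _ fun k _ => (hmono k).1)]
    refine setIntegral_congr_fun measurableSet_Ioi fun t (ht : 0 < t) => ?_
    have ht0 : (t : ℂ) ≠ 0 := by exact_mod_cast ht.ne'
    rw [binomialRemainder, ofReal_sub, ofReal_cpow (by positivity), mul_sub, mul_sub]
    push_cast
    congr 1
    rw [Finset.mul_sum, Finset.mul_sum]
    refine Finset.sum_congr rfl fun k _ => ?_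
    rw [show (ν : ℂ) + 1 + k - 1 = ν + k by ring, cpow_add _ _ ht0, cpow_natCast]
    ring
  rw [hsplit, besselK_eq_laplace]
  set J := ∫ t in Ioi (0 : ℝ), cexp (-(2 * z * t)) *
        ((t : ℂ) ^ (ν : ℂ) * (1 + (t : ℂ)) ^ (ν : ℂ))
  have hcos : (Real.sqrt Real.pi : ℂ) / cos (Real.pi * ((ν : ℂ) + 1 / 2)) =
      Gamma (-(ν : ℂ)) * Gamma (ν + 1) / Real.sqrt Real.pi := by
    rw [hrefl, ← hππ]
    field_simp
  have hsum : Gamma (-(ν : ℂ)) * (2 * z) ^ ((ν : ℂ) + 1 / 2) * ∑ k ∈ Finset.range N,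
        (binomialCoeff ν k : ℂ) * ((2 * z) ^ (-((ν : ℂ) + 1 + k)) * Gamma (ν + 1 + k)) =
      ∑ k ∈ Finset.range N, Gamma (ν + 1 + k) * Gamma (k - ν) * ((-1) ^ k / k.factorial) *
          cexp (-((1 / 2 + k) * log (2 * z))) := by
    rw [Finset.mul_sum]
    refine Finset.sum_congr rfl fun k _ => ?_
    have e4 : cexp (-((1 / 2 + k) * log (2 * z))) = (2 * z) ^ ((ν : ℂ) + 1 / 2) *
        (2 * z) ^ (-((ν : ℂ) + 1 + k)) := by
      rw [← cpow_add _ _ hz2, ← cexp_mul_log_eq_cpow hz2]; congr 1; ring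
    have hf : (k.factorial : ℂ) ≠ 0 := by exact_mod_cast k.factorial_ne_zero
    rw [e4, binomialCoeff_eq_Gamma hν']
    field_simp
  have hexp : cexp z * cexp (-z) = 1 := by rw [← Complex.exp_add]; simp
  rw [← hsum, hcos]
  calc _ = 2 * Real.pi * (Gamma (-(ν : ℂ)) * (2 * z) ^ ((ν : ℂ) + 1 / 2) * J -
        Gamma (-(ν : ℂ)) * (2 * z) ^ ((ν : ℂ) + 1 / 2) * ∑ k ∈ Finset.range N,
        (binomialCoeff ν k : ℂ) * ((2 * z) ^ (-((ν : ℂ) + 1 + k)) * Gamma (ν + 1 + k))) := by ring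
    _ = _ := by
      congr 2
      calc _ = Gamma (-(ν : ℂ)) * (2 * z) ^ ((ν : ℂ) + 1 / 2) * J *
          ((Gamma (ν + 1) * (Gamma ((ν : ℂ) + 1))⁻¹) *
          ((Real.sqrt Real.pi : ℂ) * (Real.sqrt Real.pi : ℂ)⁻¹) * (cexp z * cexp (-z))) := by
            rw [hexp, mul_inv_cancel₀ hΓ, mul_inv_cancel₀ hπ]; ring
        _ = _ := by ring

/-- Only countably many abscissae are excluded by the left poles, so some interval point below every
`Re β` survives. -/
theorem exists_meijerAbscissa (a₁ b₁ : List ℂ) : ∃ σ, IsMeijerAbscissa a₁ b₁ σ := by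
  have hlow : ∃ m : ℝ, ∀ β ∈ b₁, m < β.re := by
    induction b₁ with
    | nil => exact ⟨0, by simp⟩
    | cons b l ih =>
      obtain ⟨m, hm⟩ := ih
      refine ⟨min m (b.re - 1), fun β hβ => ?_⟩
      rcases List.mem_cons.1 hβ with rfl | hβ
      · exact (min_le_right _ _).trans_lt (by linarith)
      · exact (min_le_left _ _).trans_lt (hm β hβ)
  obtain ⟨m, hm⟩ := hlow
  have hcount : (re '' meijerLeftPoles a₁).Countable := by
    have : meijerLeftPoles a₁ ⊆ ⋃ α ∈ {α | α ∈ a₁}, range fun k : ℕ => α - 1 - (k : ℂ) := by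
      rintro w ⟨α, hα, k, rfl⟩
      simp only [mem_iUnion]
      exact ⟨α, hα, k, rfl⟩
    refine Countable.image (Countable.mono this ?_) _
    exact (List.finite_toSet a₁).countable.biUnion fun α _ => countable_range _
  obtain ⟨σ, hσ, hσm⟩ := (hcount.dense_compl ℝ).exists_between (show m - 1 < m by linarith)
  exact ⟨σ, fun β hβ => hσm.2.trans (hm β hβ), fun w hw h => hσ ⟨w, hw, h⟩⟩

/-- The abscissa in the definition is an arbitrary choice, so only its defining property is kept and
the evaluations must work for every admissible `σ`. -/
theorem meijerGLog_nil (a₂ b₁ b₂ : List ℂ) (L : ℂ) : ∃ σ : ℝ, (∀ β ∈ b₁, σ < β.re) ∧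
    meijerGLog [] a₂ b₁ b₂ L = 1 / (2 * Real.pi) *
      ∫ τ : ℝ, meijerIntegrand [] a₂ b₁ b₂ L ((σ : ℂ) + τ * I) := by
  refine ⟨_, (Classical.epsilon_spec (exists_meijerAbscissa [] b₁)).1, ?_⟩
  simp [meijerGLog, meijerLeftPoles]

/-- The pole `α - 1 - k` lies to the right of the line exactly when `k < Re α - 1 - σ`, hence the
ceiling. -/
theorem meijerGLog_singleton (α : ℂ) (a₂ b₁ b₂ : List ℂ) (L : ℂ) : ∃ σ : ℝ,
    (∀ β ∈ b₁, σ < β.re) ∧ (∀ k : ℕ, α.re - 1 - k ≠ σ) ∧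
    meijerGLog [α] a₂ b₁ b₂ L = 1 / (2 * Real.pi) *
      (∫ τ : ℝ, meijerIntegrand [α] a₂ b₁ b₂ L ((σ : ℂ) + τ * I)) +
      ∑ k ∈ Finset.range ⌈α.re - 1 - σ⌉₊,
        residueAt (meijerIntegrand [α] a₂ b₁ b₂ L) (α - 1 - k) := by
  have hs := Classical.epsilon_spec (exists_meijerAbscissa [α] b₁)
  refine ⟨_, hs.1, fun k => ?_, ?_⟩
  · have := hs.2 (α - 1 - k) ⟨α, by simp, k, rfl⟩
    simpa using this
  · rw [meijerGLog]
    congr 1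
    set σ := Classical.epsilon (IsMeijerAbscissa [α] b₁)
    have hset : {w ∈ meijerLeftPoles [α] | σ < w.re} =
        (fun k : ℕ => α - 1 - (k : ℂ)) '' (Finset.range ⌈α.re - 1 - σ⌉₊ : Set ℕ) := by
      ext w
      constructor
      · rintro ⟨⟨a, ha, k, rfl⟩, hw⟩
        rw [List.mem_singleton] at ha
        subst ha
        refine ⟨k, ?_, rfl⟩
        simp only [sub_re, one_re, natCast_re] at hw
        simp only [Finset.coe_range, mem_Iio, Nat.lt_ceil]
        linarith
      · rintro ⟨k, hk, rfl⟩
        simp only [Finset.coe_range, mem_Iio, Nat.lt_ceil] at hk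
        refine ⟨⟨α, by simp, k, rfl⟩, ?_⟩
        simp only [sub_re, one_re, natCast_re]
        linarith
    rw [hset, finsum_mem_image, finsum_mem_coe_finset]
    intro i _ j _ hij
    simpa using hij

/-- By Cauchy's formula the circle integral is already constant for small radii, so the limit in
`residueAt` is trivial. -/
theorem residueAt_of_eventuallyEq_div {f g : ℂ → ℂ} {w : ℂ}
    (hf : ∀ᶠ ζ in 𝓝[≠] w, f ζ = g ζ / (ζ - w)) (hg : ∀ᶠ ζ in 𝓝 w, DifferentiableAt ℂ g ζ) :
    residueAt f w = g w := by
  rw [residueAt]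
  refine Tendsto.limUnder_eq (tendsto_const_nhds.congr' ?_)
  rw [eventually_nhdsWithin_iff] at hf
  obtain ⟨ε, hε, hb⟩ := Metric.eventually_nhds_iff_ball.1 (hf.and hg)
  filter_upwards [Ioo_mem_nhdsGT hε] with r hr
  have hsub : Metric.closedBall w r ⊆ Metric.ball w ε := Metric.closedBall_subset_ball hr.2
  have hdiff : DifferentiableOn ℂ g (Metric.closedBall w r) := fun ζ hζ =>
    (hb ζ (hsub hζ)).2.differentiableWithinAt
  have hI := hdiff.circleIntegral_sub_inv_smul (Metric.mem_ball_self hr.1)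
  have hcongr : (∮ ζ in C(w, r), f ζ) = ∮ ζ in C(w, r), (ζ - w)⁻¹ • g ζ := by
    refine circleIntegral.integral_congr hr.1.le fun ζ hζ => ?_
    have hne : ζ ≠ w := by
      rintro rfl
      simp at hζ
      exact hr.1.ne' hζ.symm
    rw [(hb ζ (hsub (Metric.sphere_subset_closedBall hζ))).1 hne, smul_eq_mul]
    ring
  rw [hcongr, hI, smul_eq_mul, ← mul_assoc, inv_mul_cancel₀ two_pi_I_ne_zero, one_mul]

/-- `1/Γ` is continuous and nonzero at `s`, while it takes the value `0` at every pole of `Γ`; so no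
pole is near `s`. -/
theorem eventually_differentiableAt_Gamma {s : ℂ} (hs : ∀ m : ℕ, s ≠ -m) :
    ∀ᶠ u in 𝓝 s, DifferentiableAt ℂ Gamma u := by
  have h := (differentiable_one_div_Gamma s).continuousAt.eventually_ne
    (inv_ne_zero (Gamma_ne_zero hs))
  filter_upwards [h] with u hu
  refine differentiableAt_Gamma u fun m hm => hu ?_
  rw [hm, Gamma_neg_nat_eq_zero, inv_zero]

/-- Repeated use of the functional equation isolates the simple pole at `u = 0`; `‖u‖ < 1` keeps the
other factors away from zero. -/
theorem Gamma_sub_natCast {u : ℂ} (hu : u ≠ 0) (hu' : ‖u‖ < 1) (k : ℕ) :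
    Gamma (u - k) = Gamma (u + 1) / (∏ j ∈ Finset.range k, (u - (j + 1))) / u := by
  have hne : ∀ j : ℕ, u - (j + 1) ≠ 0 := by
    intro j h
    have : ‖u‖ = j + 1 := by
      rw [sub_eq_zero.1 h]
      exact_mod_cast Complex.norm_natCast (j + 1)
    have hj : (0 : ℝ) ≤ j := j.cast_nonneg
    linarith
  induction k with
  | zero => rw [Gamma_add_one u hu]; simp [hu]
  | succ k ih =>
    have h1 : u - (k : ℂ) = (u - (k + 1)) + 1 := by ring
    rw [h1, Gamma_add_one _ (hne k)] at ih
    rw [Finset.prod_range_succ]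
    push_cast
    have hprod : ∏ j ∈ Finset.range k, (u - ((j : ℂ) + 1)) ≠ 0 :=
      Finset.prod_ne_zero_iff.2 fun j _ => hne j
    have := hne k
    field_simp at ih ⊢
    linear_combination ih

theorem prod_range_neg_succ (k : ℕ) :
    ∏ j ∈ Finset.range k, (0 - ((j : ℂ) + 1)) = (-1) ^ k * k.factorial := by
  induction k with
  | zero => simp
  | succ k ih => rw [Finset.prod_range_succ, ih, Nat.factorial_succ]; push_cast; ring

theorem residueAt_mul_Gamma {φ : ℂ → ℂ} {α : ℂ} (k : ℕ)
    (hφ : ∀ᶠ ζ in 𝓝 (α - 1 - k), DifferentiableAt ℂ φ ζ) :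
    residueAt (fun ζ => φ ζ * Gamma (1 - α + ζ)) (α - 1 - k) =
      φ (α - 1 - k) * ((-1) ^ k / k.factorial) := by
  set w : ℂ := α - 1 - k with hw
  have hball : ∀ᶠ ζ in 𝓝 w, ‖ζ - w‖ < 1 := by
    filter_upwards [Metric.ball_mem_nhds w one_pos] with ζ hζ
    simpa [dist_eq_norm] using hζ
  have h := residueAt_of_eventuallyEq_div (f := fun ζ => φ ζ * Gamma (1 - α + ζ)) (w := w)
    (g := fun ζ => φ ζ * (Gamma (ζ - w + 1) / ∏ j ∈ Finset.range k, (ζ - w - (j + 1)))) ?_ ?_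
  · rw [h]
    simp only [sub_self, zero_add, Gamma_one]
    rw [prod_range_neg_succ]
    congr 1
    have h1 : ((-1 : ℂ) ^ k) * (-1) ^ k = 1 := by rw [← mul_pow]; simp
    have hf : (k.factorial : ℂ) ≠ 0 := by exact_mod_cast k.factorial_ne_zero
    have h2 : ((-1 : ℂ) ^ k) ≠ 0 := by simp
    field_simp
    linear_combination -h1
  · filter_upwards [nhdsWithin_le_nhds hball, self_mem_nhdsWithin] with ζ h1 h2
    have := Gamma_sub_natCast (sub_ne_zero.2 h2) h1 k
    rw [show 1 - α + ζ = ζ - w - k by rw [hw]; ring, this]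
    ring
  · filter_upwards [hball, hφ] with ζ h1 h2
    have hre : -1 < (ζ - w).re := by
      have := (abs_le.1 ((abs_re_le_norm (ζ - w)))).1
      linarith
    refine h2.mul (DifferentiableAt.div ?_ ?_ ?_)
    · refine DifferentiableAt.comp (g := Gamma) (f := fun ζ => ζ - w + 1) ζ ?_ (by fun_prop)
      refine differentiableAt_Gamma _ fun m hm => ?_
      have := congrArg re hm
      simp only [add_re, one_re, neg_re, natCast_re] at this
      have hm0 : (0 : ℝ) ≤ m := m.cast_nonneg
      linarith
    · fun_prop
    · refine Finset.prod_ne_zero_iff.2 fun j _ hj => ?_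
      have : ‖ζ - w‖ = j + 1 := by
        rw [sub_eq_zero.1 hj]
        exact_mod_cast Complex.norm_natCast (j + 1)
      have hj : (0 : ℝ) ≤ j := j.cast_nonneg
      linarith

/-- The substitution `s = μ - nζ` maps a vertical line to a vertical line: `n` is the power of `z`
in the argument of `G`, `μ` the shift of its parameters. -/
theorem integral_comp_sub_nat_mul (H : ℂ → ℂ) (μ : ℂ) (n : ℕ) (σ : ℝ) :
    ∫ τ : ℝ, H (μ - n * ((σ : ℂ) + τ * I)) =
      (n : ℂ)⁻¹ * ∫ y : ℝ, H (((μ.re - n * σ : ℝ) : ℂ) + y * I) := by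
  have h1 : ∀ τ : ℝ, H (μ - n * ((σ : ℂ) + τ * I)) =
      (fun y : ℝ => H (((μ.re - n * σ : ℝ) : ℂ) + ((μ.im - y : ℝ) : ℂ) * I)) ((n : ℝ) * τ) := by
    intro τ
    simp only
    congr 1
    conv_lhs => rw [← re_add_im μ]
    push_cast
    ring
  simp_rw [h1]
  rw [Measure.integral_comp_mul_left
    (fun y : ℝ => H (((μ.re - n * σ : ℝ) : ℂ) + ((μ.im - y : ℝ) : ℂ) * I)), integral_sub_left_eq_self
    (fun y : ℝ => H (((μ.re - n * σ : ℝ) : ℂ) + (y : ℂ) * I)) volume μ.im, real_smul,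
    abs_of_nonneg (by positivity)]
  push_cast
  rfl

end MeijerValues

/-! ### The four Meijer functions evaluated as Bessel functions. -/

section MeijerBessel
open Complex MeasureTheory Set Filter Topology

theorem two_pi_ne_zero_complex : (2 * Real.pi : ℂ) ≠ 0 := by
  simp [Real.pi_ne_zero]

theorem log_div_ofReal {z : ℂ} (hz : z ≠ 0) {r : ℝ} (hr : 0 < r) :
    log (z / r) = log z - log r := by
  have := log_mul_ofReal r⁻¹ (inv_pos.2 hr) z hz
  rw [div_eq_mul_inv, ← ofReal_inv, this, Real.log_inv, ofReal_neg, ofReal_log hr.le]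
  ring

/-- `G^{2,0}_{1,2}(2 z) = e^{-z} K_{ν+1/2}(z) / √π`. -/
theorem meijerG_two_zero_one_two {ν : ℝ} (hν : 0 ≤ ν) {z : ℂ} (hz : 0 < z.re) :
    meijerG [] [1 / 2] [(ν : ℂ) + 1 / 2, -(ν : ℂ) - 1 / 2] [] (2 * z) =
      cexp (-z) * besselK ((ν : ℂ) + 1 / 2) z / Real.sqrt Real.pi := by
  obtain ⟨σ, hσ, h⟩ := meijerGLog_nil [1 / 2] [(ν : ℂ) + 1 / 2, -(ν : ℂ) - 1 / 2] [] (log (2 * z))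
  -- Lying to the left of the poles of `Γ(β - ζ)` is, after `s = -ζ`, the hypothesis on the abscissa
  -- in the Barnes integral.
  have hσ' : ν + 1 / 2 < -σ := by
    have := hσ (-(ν : ℂ) - 1 / 2) (by simp)
    simp at this
    linarith
  have hI := integral_comp_sub_nat_mul (fun s => Gamma (s + (ν + 1 / 2)) *
    Gamma (s - (ν + 1 / 2)) / Gamma (s + 1 / 2) * cexp (-(s * log (2 * z)))) 0 1 σ
  have e : ((0 : ℂ).re - (1 : ℕ) * σ : ℝ) = -σ := by simp
  simp only [e] at hI
  rw [integral_barnes_exp_neg_mul_besselK hν hσ' hz] at hI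
  rw [meijerG, h]
  have hc : ∀ τ : ℝ, meijerIntegrand [] [1 / 2] [(ν : ℂ) + 1 / 2, -(ν : ℂ) - 1 / 2] []
      (log (2 * z)) ((σ : ℂ) + τ * I) = (fun s => Gamma (s + (ν + 1 / 2)) *
      Gamma (s - (ν + 1 / 2)) / Gamma (s + 1 / 2) * cexp (-(s * log (2 * z))))
      (0 - (1 : ℕ) * ((σ : ℂ) + τ * I)) := by
    intro τ
    simp only [meijerIntegrand, List.map_cons, List.map_nil, List.prod_cons, List.prod_nil,
      mul_one, one_mul, Nat.cast_one, zero_sub, neg_mul, neg_neg]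
    ring_nf
  simp_rw [hc]
  rw [hI, Nat.cast_one, inv_one, one_mul, ← mul_assoc,
    one_div_mul_cancel two_pi_ne_zero_complex, one_mul]

/-- `G^{2,1}_{1,2}(2 z) = √π (2 z)^μ e^z K_{ν+1/2}(z) / cos π(ν+1/2)`. -/
theorem meijerG_two_one_one_two {ν : ℝ} (hν : 0 ≤ ν) (hν' : ∀ k : ℕ, ν ≠ k) (μ : ℂ) {z : ℂ}
    (hz : 0 < z.re) :
    meijerG [μ + 1 / 2] [] [μ + (ν + 1 / 2), μ - (ν + 1 / 2)] [] (2 * z) =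
      cexp (μ * log (2 * z)) * (Real.sqrt Real.pi / cos (Real.pi * ((ν : ℂ) + 1 / 2)) *
        (cexp z * besselK ((ν : ℂ) + 1 / 2) z)) := by
  set L := log (2 * z) with hL
  obtain ⟨σ, hσ, hσk, h⟩ := meijerGLog_singleton (μ + 1 / 2) []
    [μ + (ν + 1 / 2), μ - (ν + 1 / 2)] [] L
  have hσ' : ν + 1 / 2 < μ.re - σ := by
    have := hσ (μ - (ν + 1 / 2)) (by simp)
    simp at this
    linarith
  have hx : (μ + 1 / 2 : ℂ).re - 1 - σ = μ.re - σ - 1 / 2 := by simp; ring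
  rw [hx] at h
  -- The number of loops is also the number of binomial terms to subtract.
  set N := ⌈μ.re - σ - 1 / 2⌉₊ with hN
  have hN1 : (N : ℝ) - 1 / 2 < μ.re - σ := by
    have := Nat.ceil_lt_add_one (show 0 ≤ μ.re - σ - 1 / 2 by linarith)
    linarith
  -- Strict because no left pole lies on the line; equality would put the pole with index `N` there.
  have hN2 : μ.re - σ < N + 1 / 2 := by
    have h1 := Nat.le_ceil (μ.re - σ - 1 / 2)
    have h2 := hσk N
    have h3 : (μ + 1 / 2 : ℂ).re - 1 - N = μ.re - 1 / 2 - N := by simp; ring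
    rw [h3] at h2
    refine lt_of_le_of_ne (by linarith) fun h4 => h2 ?_
    linarith
  have hI := integral_comp_sub_nat_mul (fun s => Gamma (s + (ν + 1 / 2)) *
    Gamma (s - (ν + 1 / 2)) * Gamma (1 / 2 - s) * cexp (-(s * L))) μ 1 σ
  have e : (μ.re - (1 : ℕ) * σ : ℝ) = μ.re - σ := by simp
  simp only [e] at hI
  rw [integral_barnes_exp_mul_besselK hν hν' hσ' hN1 hN2 hz] at hI
  have hm : ∀ ζ : ℂ, meijerIntegrand [μ + 1 / 2] [] [μ + (ν + 1 / 2), μ - (ν + 1 / 2)] [] L ζ =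
      Gamma (μ + (ν + 1 / 2) - ζ) * Gamma (μ - (ν + 1 / 2) - ζ) * cexp (ζ * L) *
        Gamma (1 - (μ + 1 / 2) + ζ) := by
    intro ζ
    simp only [meijerIntegrand, List.map_cons, List.map_nil, List.prod_cons, List.prod_nil,
      mul_one, div_one]
    ring
  have hc : ∀ τ : ℝ, meijerIntegrand [μ + 1 / 2] [] [μ + (ν + 1 / 2), μ - (ν + 1 / 2)] []
      L ((σ : ℂ) + τ * I) = cexp (μ * L) * (fun s => Gamma (s + (ν + 1 / 2)) *
      Gamma (s - (ν + 1 / 2)) * Gamma (1 / 2 - s) * cexp (-(s * L)))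
      (μ - (1 : ℕ) * ((σ : ℂ) + τ * I)) := by
    intro τ
    rw [hm]
    simp only [Nat.cast_one, one_mul]
    set ζ := (σ : ℂ) + τ * I
    have e1 : cexp (ζ * L) = cexp (μ * L) * cexp (-((μ - ζ) * L)) := by
      rw [← Complex.exp_add]; congr 1; ring
    rw [e1, show μ + (ν + 1 / 2) - ζ = μ - ζ + (ν + 1 / 2) by ring,
      show μ - (ν + 1 / 2) - ζ = μ - ζ - (ν + 1 / 2) by ring,
      show 1 - (μ + 1 / 2) + ζ = 1 / 2 - (μ - ζ) by ring]
    ring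
  -- Each residue is the corresponding term subtracted in the Barnes integral, so the two finite
  -- sums cancel.
  have hres : ∀ k : ℕ, residueAt
      (meijerIntegrand [μ + 1 / 2] [] [μ + (ν + 1 / 2), μ - (ν + 1 / 2)] [] L)
      (μ + 1 / 2 - 1 - k) = cexp (μ * L) * (Gamma (ν + 1 + k) * Gamma (k - ν) *
        ((-1) ^ k / k.factorial) * cexp (-((1 / 2 + k) * L))) := by
    intro k
    rw [funext hm, residueAt_mul_Gamma k]
    · have e1 : μ + (ν + 1 / 2) - (μ + 1 / 2 - 1 - k) = ν + 1 + k := by ring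
      have e2 : μ - (ν + 1 / 2) - (μ + 1 / 2 - 1 - k) = k - ν := by ring
      have e3 : cexp ((μ + 1 / 2 - 1 - k) * L) = cexp (μ * L) * cexp (-((1 / 2 + k) * L)) := by
        rw [← Complex.exp_add]; congr 1; ring
      rw [e1, e2, e3]
      ring
    · have key : ∀ b : ℂ, (∀ m : ℕ, b - (μ + 1 / 2 - 1 - k) ≠ -m) →
          ∀ᶠ ζ in 𝓝 (μ + 1 / 2 - 1 - (k : ℂ)), DifferentiableAt ℂ (fun ζ => Gamma (b - ζ)) ζ := by
        intro b hb
        have ht : Tendsto (fun ζ : ℂ => b - ζ) (𝓝 (μ + 1 / 2 - 1 - (k : ℂ)))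
            (𝓝 (b - (μ + 1 / 2 - 1 - (k : ℂ)))) := Continuous.tendsto (by fun_prop) _
        filter_upwards [ht.eventually (eventually_differentiableAt_Gamma hb)] with ζ hζ
        exact DifferentiableAt.comp (g := Gamma) (f := fun ζ => b - ζ) ζ hζ (by fun_prop)
      have k1 := key (μ + (ν + 1 / 2)) (fun m hm => by
        rw [show μ + (ν + 1 / 2) - (μ + 1 / 2 - 1 - k) = ((ν + 1 + k : ℝ) : ℂ) by
          push_cast; ring] at hm
        have h1 : ν + 1 + k = -m := by exact_mod_cast hm
        have h2 : (0 : ℝ) ≤ k := k.cast_nonneg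
        have h3 : (0 : ℝ) ≤ m := m.cast_nonneg
        linarith)
      -- This is where `ν` must not be a natural number: otherwise a pole of `Γ(β - ζ)` would meet
      -- one of `Γ(1 - α + ζ)`.
      have k2 := key (μ - (ν + 1 / 2)) (fun m hm => by
        rw [show μ - (ν + 1 / 2) - (μ + 1 / 2 - 1 - k) = ((k - ν : ℝ) : ℂ) by
          push_cast; ring] at hm
        have h1 : (k : ℝ) - ν = -m := by exact_mod_cast hm
        refine hν' (k + m) ?_
        push_cast
        linarith)
      filter_upwards [k1, k2] with ζ h1 h2
      exact (h1.mul h2).mul (by fun_prop)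
  rw [meijerG, h]
  simp_rw [hres, hc]
  rw [integral_const_mul, hI, ← Finset.mul_sum, Nat.cast_one, inv_one, one_mul]
  have := two_pi_ne_zero_complex
  rw [mul_left_comm, ← mul_assoc (1 / (2 * (Real.pi : ℂ))), one_div_mul_cancel this, one_mul,
    ← mul_add, sub_add_cancel]

/-- `G^{2,0}_{0,2}(z² / 4) = 2 (z / 2)^μ K_{ν+1/2}(z)`, with `L` the logarithm of the argument. -/
theorem meijerGLog_two_zero_zero_two {ν : ℝ} (hν : 0 ≤ ν) (μ : ℂ) {z : ℂ} (hz : 0 < z.re) :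
    meijerGLog [] [] [(μ + (ν + 1 / 2)) / 2, (μ - (ν + 1 / 2)) / 2] [] (2 * log (z / 2)) =
      2 * cexp (μ * log (z / 2)) * besselK ((ν : ℂ) + 1 / 2) z := by
  set L := log (z / 2) with hL
  obtain ⟨σ, hσ, h⟩ := meijerGLog_nil [] [(μ + (ν + 1 / 2)) / 2, (μ - (ν + 1 / 2)) / 2] []
    (2 * L)
  have e : (μ.re - (2 : ℕ) * σ : ℝ) = μ.re - 2 * σ := by simp
  have hσ' : ν + 1 / 2 < μ.re - 2 * σ := by
    have := hσ ((μ - (ν + 1 / 2)) / 2) (by simp)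
    rw [show (μ - ((ν : ℂ) + 1 / 2)) / 2 = ((1 / 2 : ℝ) : ℂ) * (μ - (ν + 1 / 2)) by
      push_cast; ring, re_ofReal_mul] at this
    simp at this
    linarith
  have hI := integral_comp_sub_nat_mul (fun s => Gamma ((s + (ν + 1 / 2)) / 2) *
    Gamma ((s - (ν + 1 / 2)) / 2) * cexp (-(s * L))) μ 2 σ
  simp only [e] at hI
  rw [integral_barnes_besselK hν hσ' hz] at hI
  have hc : ∀ τ : ℝ, meijerIntegrand [] [] [(μ + (ν + 1 / 2)) / 2, (μ - (ν + 1 / 2)) / 2] []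
      (2 * L) ((σ : ℂ) + τ * I) = cexp (μ * L) * (fun s => Gamma ((s + (ν + 1 / 2)) / 2) *
      Gamma ((s - (ν + 1 / 2)) / 2) * cexp (-(s * L))) (μ - (2 : ℕ) * ((σ : ℂ) + τ * I)) := by
    intro τ
    simp only [meijerIntegrand, List.map_cons, List.map_nil, List.prod_cons, List.prod_nil,
      mul_one, div_one, Nat.cast_ofNat]
    set ζ := (σ : ℂ) + τ * I
    have e1 : cexp (ζ * (2 * L)) = cexp (μ * L) * cexp (-((μ - 2 * ζ) * L)) := by
      rw [← Complex.exp_add]; congr 1; ring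
    rw [e1, show (μ + (ν + 1 / 2)) / 2 - ζ = (μ - 2 * ζ + (ν + 1 / 2)) / 2 by ring,
      show (μ - (ν + 1 / 2)) / 2 - ζ = (μ - 2 * ζ - (ν + 1 / 2)) / 2 by ring]
    ring
  rw [h]
  simp_rw [hc]
  rw [integral_const_mul, hI]
  have := two_pi_ne_zero_complex
  push_cast
  field_simp
  norm_num

/-- `G^{4,0}_{0,4}((z / 4)⁴) = 4 π 2^{-μ} (z / 2)^μ K_{ν+1/2}(z)`, with `L` the logarithm of the
argument. -/
theorem meijerGLog_four_zero_zero_four {ν : ℝ} (hν : 0 ≤ ν) (μ : ℂ) {z : ℂ} (hz : 0 < z.re) :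
    meijerGLog [] [] [(μ + (ν + 1 / 2)) / 4, (μ + (ν + 1 / 2)) / 4 + 1 / 2,
      (μ - (ν + 1 / 2)) / 4, (μ - (ν + 1 / 2)) / 4 + 1 / 2] [] (4 * log (z / 4)) =
      4 * Real.pi * cexp (μ * (log (z / 2) - log 2)) * besselK ((ν : ℂ) + 1 / 2) z := by
  have hz0 : z ≠ 0 := by rintro rfl; simp at hz
  have hL4 : log (z / 4) = log (z / 2) - log 2 := by
    have := log_div_ofReal (z := z / 2) (by simpa using hz0) (r := 2) two_pos
    rw [ofReal_ofNat] at this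
    rw [← this]
    congr 1
    ring
  rw [hL4]
  set L := log (z / 2) with hL
  obtain ⟨σ, hσ, h⟩ := meijerGLog_nil [] [(μ + (ν + 1 / 2)) / 4, (μ + (ν + 1 / 2)) / 4 + 1 / 2,
      (μ - (ν + 1 / 2)) / 4, (μ - (ν + 1 / 2)) / 4 + 1 / 2] [] (4 * (L - log 2))
  have e : (μ.re - (4 : ℕ) * σ : ℝ) = μ.re - 4 * σ := by simp
  have hσ' : ν + 1 / 2 < μ.re - 4 * σ := by
    have := hσ ((μ - (ν + 1 / 2)) / 4) (by simp)
    rw [show (μ - ((ν : ℂ) + 1 / 2)) / 4 = ((1 / 4 : ℝ) : ℂ) * (μ - (ν + 1 / 2)) by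
      push_cast; ring, re_ofReal_mul] at this
    simp at this
    linarith
  have hI := integral_comp_sub_nat_mul (fun s => Gamma ((s + (ν + 1 / 2)) / 2) *
    Gamma ((s - (ν + 1 / 2)) / 2) * cexp (-(s * L))) μ 4 σ
  simp only [e] at hI
  rw [integral_barnes_besselK hν hσ' hz] at hI
  have hππ : (Real.sqrt Real.pi : ℂ) * Real.sqrt Real.pi = Real.pi := by
    rw [← ofReal_mul, Real.mul_self_sqrt Real.pi_pos.le]
  have hc : ∀ τ : ℝ, meijerIntegrand [] [] [(μ + (ν + 1 / 2)) / 4, (μ + (ν + 1 / 2)) / 4 + 1 / 2,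
      (μ - (ν + 1 / 2)) / 4, (μ - (ν + 1 / 2)) / 4 + 1 / 2] []
      (4 * (L - log 2)) ((σ : ℂ) + τ * I) = 4 * Real.pi * cexp (μ * (L - log 2)) *
      (fun s => Gamma ((s + (ν + 1 / 2)) / 2) *
      Gamma ((s - (ν + 1 / 2)) / 2) * cexp (-(s * L))) (μ - (4 : ℕ) * ((σ : ℂ) + τ * I)) := by
    intro τ
    simp only [meijerIntegrand, List.map_cons, List.map_nil, List.prod_cons, List.prod_nil,
      mul_one, div_one, Nat.cast_ofNat]
    set ζ := (σ : ℂ) + τ * I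
    -- Duplication merges the two Gamma factors differing by `1/2`, reducing the integrand to the
    -- one for two parameters.
    have hd : ∀ d : ℂ, Gamma ((μ + d) / 4 - ζ) * Gamma ((μ + d) / 4 + 1 / 2 - ζ) =
        Gamma ((μ - 4 * ζ + d) / 2) * 2 ^ (1 - (μ - 4 * ζ + d) / 2) * Real.sqrt Real.pi := by
      intro d
      have := Gamma_mul_Gamma_add_half ((μ + d) / 4 - ζ)
      rw [show 2 * ((μ + d) / 4 - ζ) = (μ - 4 * ζ + d) / 2 by ring] at this
      rw [← this]
      congr 2
      ring
    have h1 := hd (ν + 1 / 2)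
    have h2 := hd (-(ν + 1 / 2))
    simp only [← sub_eq_add_neg] at h2
    have hpow : (2 : ℂ) ^ (1 - (μ - 4 * ζ + (ν + 1 / 2)) / 2) *
        2 ^ (1 - (μ - 4 * ζ - (ν + 1 / 2)) / 2) * cexp (ζ * (4 * (L - log 2))) =
        4 * cexp (μ * (L - log 2)) * cexp (-((μ - 4 * ζ) * L)) := by
      have h4 : (4 : ℂ) = cexp (2 * log 2) := by
        rw [two_mul, Complex.exp_add, exp_log two_ne_zero]; norm_num
      rw [cpow_def_of_ne_zero two_ne_zero, cpow_def_of_ne_zero two_ne_zero, ← Complex.exp_add,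
        ← Complex.exp_add]
      conv_rhs => rw [show (4 : ℂ) * cexp (μ * (L - log 2)) =
        cexp (2 * log 2) * cexp (μ * (L - log 2)) by rw [← h4]]
      rw [← Complex.exp_add, ← Complex.exp_add]
      congr 1
      ring
    calc _ = (Gamma ((μ + (ν + 1 / 2)) / 4 - ζ) * Gamma ((μ + (ν + 1 / 2)) / 4 + 1 / 2 - ζ)) *
          (Gamma ((μ - (ν + 1 / 2)) / 4 - ζ) * Gamma ((μ - (ν + 1 / 2)) / 4 + 1 / 2 - ζ)) *
          cexp (ζ * (4 * (L - log 2))) := by ring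
      _ = ((2 : ℂ) ^ (1 - (μ - 4 * ζ + (ν + 1 / 2)) / 2) *
        2 ^ (1 - (μ - 4 * ζ - (ν + 1 / 2)) / 2) * cexp (ζ * (4 * (L - log 2)))) *
          (Real.sqrt Real.pi * Real.sqrt Real.pi) *
          (Gamma ((μ - 4 * ζ + (ν + 1 / 2)) / 2) * Gamma ((μ - 4 * ζ - (ν + 1 / 2)) / 2)) := by
          rw [h1, h2]; ring
      _ = _ := by rw [hpow, hππ]; ring
  rw [h]
  simp_rw [hc]
  rw [integral_const_mul, hI]
  have := two_pi_ne_zero_complex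
  have h4 : (4 : ℂ)⁻¹ * 4 = 1 := by norm_num
  push_cast
  calc _ = (1 / (2 * (Real.pi : ℂ)) * (2 * Real.pi)) * ((4 : ℂ)⁻¹ * 4) *
      (4 * Real.pi * cexp (μ * (L - log 2)) * besselK ((ν : ℂ) + 1 / 2) z) := by ring
    _ = _ := by rw [one_div_mul_cancel this, h4, one_mul, one_mul]

end MeijerBessel

/-! ### The Euler integral of the extended Appell function and uniqueness of its continuation. -/

section ExtendedAppell
open Complex MeasureTheory Set Filter Topology

theorem measurable_besselK (ν : ℝ) : Measurable fun z : ℂ => besselK ((ν : ℂ) + 1 / 2) z := by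
  simp_rw [besselK_eq_laplace]
  have h : StronglyMeasurable fun z : ℂ => ∫ t in Ioi (0 : ℝ),
      cexp (-(2 * z * t)) * ((t : ℂ) ^ (ν : ℂ) * (1 + (t : ℂ)) ^ (ν : ℂ)) :=
    StronglyMeasurable.integral_prod_right' (f := fun q : ℂ × ℝ =>
      cexp (-(2 * q.1 * q.2)) * ((q.2 : ℂ) ^ (ν : ℂ) * (1 + (q.2 : ℂ)) ^ (ν : ℂ)))
      (by fun_prop : Measurable _).stronglyMeasurable
  have := h.measurable
  fun_prop

/-- Exponential decay of the Macdonald function along a ray. -/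
theorem norm_besselK_ray_le {ν : ℝ} (hν : 0 ≤ ν) {p : ℂ} (hp : 0 < p.re) :
    ∃ C, 0 ≤ C ∧ ∀ r : ℝ, 1 ≤ r →
      ‖besselK ((ν : ℂ) + 1 / 2) (p * r)‖ ≤ C * r ^ (ν + 1 / 2) * Real.exp (-(p.re * r)) := by
  have hp0 : p ≠ 0 := by rintro rfl; simp at hp
  set M := ∫ t in Ioi (0 : ℝ), ‖cexp (-(2 * p * t)) *
    ((t : ℂ) ^ (ν : ℂ) * (1 + (t : ℂ)) ^ (ν : ℂ))‖ with hM
  have hM0 : 0 ≤ M := integral_nonneg fun _ => norm_nonneg _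
  have hint := integrableOn_laplace_kernel hν (w := 2 * p) (by simpa using hp)
  refine ⟨‖(Real.sqrt Real.pi : ℂ)‖ * ‖(2 * p) ^ ((ν : ℂ) + 1 / 2)‖ *
    (‖(Gamma ((ν : ℂ) + 1))⁻¹‖ * M), by positivity, fun r hr => ?_⟩
  have hr0 : 0 < r := by linarith
  have h1 : ‖(2 * (p * r)) ^ ((ν : ℂ) + 1 / 2)‖ =
      ‖(2 * p) ^ ((ν : ℂ) + 1 / 2)‖ * r ^ (ν + 1 / 2) := by
    have e : 2 * (p * r) = (r : ℂ) * (2 * p) := by ring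
    have h2p : 2 * p ≠ 0 := by simpa using hp0
    have hr0' : (r : ℂ) ≠ 0 := by exact_mod_cast hr0.ne'
    rw [e, ← cexp_mul_log_eq_cpow (mul_ne_zero hr0' h2p), log_ofReal_mul hr0 h2p, mul_add,
      Complex.exp_add, cexp_mul_log_eq_cpow h2p, ofReal_log hr0.le, cexp_mul_log_eq_cpow hr0',
      norm_mul, norm_cpow_eq_rpow_re_of_pos hr0, mul_comm]
    congr 2
    simp
  have h2 : ‖cexp (-(p * r))‖ = Real.exp (-(p.re * r)) := by
    rw [norm_exp]; simp
  have h3 : ‖∫ t in Ioi (0 : ℝ), cexp (-(2 * (p * r) * t)) *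
      ((t : ℂ) ^ (ν : ℂ) * (1 + (t : ℂ)) ^ (ν : ℂ))‖ ≤ M := by
    -- For `r ≥ 1` the Laplace kernel is dominated by its value at `r = 1`.
    refine (norm_integral_le_integral_norm _).trans ?_
    refine setIntegral_mono_on (integrableOn_laplace_kernel hν
      (by simp; positivity)).norm hint.norm measurableSet_Ioi fun t (ht : 0 < t) => ?_
    have e1 : (-(2 * (p * r) * t)).re = -(2 * (p.re * r) * t) := by simp
    have e2 : (-(2 * p * t)).re = -(2 * p.re * t) := by simp
    simp only [norm_mul, norm_exp, e1, e2]
    refine mul_le_mul_of_nonneg_right (Real.exp_le_exp.2 ?_) (by positivity)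
    nlinarith [mul_pos hp ht]
  rw [besselK_eq_laplace, norm_mul, norm_mul, norm_mul, norm_mul, h1, h2]
  calc _ ≤ ‖(Real.sqrt Real.pi : ℂ)‖ * (‖(2 * p) ^ ((ν : ℂ) + 1 / 2)‖ * r ^ (ν + 1 / 2)) *
      Real.exp (-(p.re * r)) * (‖(Gamma ((ν : ℂ) + 1))⁻¹‖ * M) := by gcongr
    _ = _ := by ring

theorem rpow_mul_exp_neg_bounded (B : ℝ) {δ : ℝ} (hδ : 0 < δ) :
    ∃ C, ∀ r : ℝ, 1 ≤ r → r ^ B * Real.exp (-(δ * r)) ≤ C := by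
  refine ⟨⌈B⌉₊.factorial / δ ^ ⌈B⌉₊, fun r hr => ?_⟩
  have hr0 : 0 < r := by linarith
  have h1 : r ^ B ≤ r ^ ⌈B⌉₊ := by
    rw [← Real.rpow_natCast]
    exact Real.rpow_le_rpow_of_exponent_le hr (Nat.le_ceil B)
  have h2 := Real.pow_div_factorial_le_exp (x := δ * r) (by positivity) ⌈B⌉₊
  rw [Real.exp_neg, ← div_eq_mul_inv, div_le_div_iff₀ (Real.exp_pos _) (by positivity)]
  rw [div_le_iff₀ (by positivity), mul_pow] at h2
  calc r ^ B * δ ^ ⌈B⌉₊ ≤ r ^ ⌈B⌉₊ * δ ^ ⌈B⌉₊ := by gcongr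
    _ = δ ^ ⌈B⌉₊ * r ^ ⌈B⌉₊ := mul_comm _ _
    _ ≤ _ := by rw [mul_comm (_ : ℝ) (Real.exp _)]; exact h2

/-- The weight `t ^ (b - 3/2) (1 - t) ^ (d - 3/2) K_{ν+1/2}(p / (t (1 - t)))`. -/
noncomputable def extBetaKernel (p : ℂ) (ν : ℝ) (b d : ℂ) (t : ℝ) : ℂ :=
  (t : ℂ) ^ (b - 3 / 2) * (1 - (t : ℂ)) ^ (d - 3 / 2) *
    besselK ((ν : ℂ) + 1 / 2) (p / (t * (1 - t)))

theorem rpow_le_rpow_abs_of_inv_le {t r A : ℝ} (ht : 0 < t) (htr : t⁻¹ ≤ r)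
    (ht1 : t ≤ 1) : t ^ A ≤ r ^ |A| := by
  calc t ^ A ≤ t ^ (-|A|) := Real.rpow_le_rpow_of_exponent_ge ht ht1 (neg_abs_le A)
    _ = t⁻¹ ^ |A| := by rw [Real.rpow_neg ht.le, Real.inv_rpow ht.le]
    _ ≤ r ^ |A| := Real.rpow_le_rpow (by positivity) htr (abs_nonneg A)

/-- With `r = 1/(t(1-t))`, all powers of `t` and `1 - t` are bounded by powers of `r`, and `e^(-r Re
p)` beats these. The kernel is therefore bounded for arbitrary exponents `b`, `d`. -/
theorem intervalIntegrable_extBetaKernel {p : ℂ} (hp : 0 < p.re) {ν : ℝ} (hν : 0 ≤ ν) (b d : ℂ) :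
    IntervalIntegrable (extBetaKernel p ν b d) volume 0 1 := by
  rw [intervalIntegrable_iff_integrableOn_Ioo_of_le zero_le_one]
  obtain ⟨C, hC0, hC⟩ := norm_besselK_ray_le hν hp
  set A := |(b - 3 / 2).re|
  set D := |(d - 3 / 2).re|
  obtain ⟨C', hC'⟩ := rpow_mul_exp_neg_bounded (A + D + (ν + 1 / 2)) hp
  refine Measure.integrableOn_of_bounded (M := C * C') (by simp) ?_ ?_
  · have := measurable_besselK ν
    exact (by unfold extBetaKernel; fun_prop : Measurable (extBetaKernel p ν b d))
      |>.aestronglyMeasurable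
  · filter_upwards [ae_restrict_mem measurableSet_Ioo] with t ⟨h0, h1⟩
    have h1' : 0 < 1 - t := by linarith
    set r := (t * (1 - t))⁻¹ with hr
    have hr1 : 1 ≤ r := (one_le_inv₀ (by positivity)).2 (by nlinarith)
    have hr0 : 0 < r := by linarith
    have e1 : (p / (t * (1 - t)) : ℂ) = p * r := by rw [hr]; push_cast; rfl
    have n1 : ‖(t : ℂ) ^ (b - 3 / 2)‖ ≤ r ^ A := by
      rw [norm_cpow_eq_rpow_re_of_pos h0]
      exact rpow_le_rpow_abs_of_inv_le h0
        (inv_anti₀ (by positivity) (by nlinarith)) h1.le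
    have n2 : ‖(1 - (t : ℂ)) ^ (d - 3 / 2)‖ ≤ r ^ D := by
      rw [← ofReal_one, ← ofReal_sub, norm_cpow_eq_rpow_re_of_pos h1']
      exact rpow_le_rpow_abs_of_inv_le h1'
        (inv_anti₀ (by positivity) (by nlinarith)) (by linarith)
    rw [extBetaKernel, norm_mul, norm_mul, e1]
    calc _ ≤ r ^ A * r ^ D * (C * r ^ (ν + 1 / 2) * Real.exp (-(p.re * r))) := by
          gcongr
          exact hC r hr1
      _ = C * (r ^ (A + D + (ν + 1 / 2)) * Real.exp (-(p.re * r))) := by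
          rw [Real.rpow_add hr0 (A + D), Real.rpow_add hr0 A]; ring
      _ ≤ C * C' := by gcongr; exact hC' r hr1

/-- The point lies on the segment from `1` to `1 - x`, and the slit plane is star-shaped about `1`.
-/
theorem one_sub_mul_mem_slitPlane {x : ℂ} (hx : x ∈ cutPlane) {t : ℝ} (h0 : 0 ≤ t) (h1 : t ≤ 1) :
    1 - x * t ∈ slitPlane := by
  have hx' : 1 + -x ∈ slitPlane := by rw [← sub_eq_add_neg]; exact hx
  have := starConvex_one_slitPlane.add_smul_mem hx' h0 h1
  rw [real_smul] at this
  convert! this using 1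
  ring

theorem isOpen_cutPlane : IsOpen cutPlane :=
  isOpen_slitPlane.preimage (by fun_prop : Continuous fun x : ℂ => 1 - x)

theorem mem_cutPlane_of_norm_lt_one {x : ℂ} (hx : ‖x‖ < 1) : x ∈ cutPlane := by
  have := mem_slitPlane_of_norm_lt_one (z := -x) (by simpa using hx)
  rwa [← sub_eq_add_neg] at this

theorem isPreconnected_cutPlane : IsPreconnected cutPlane := by
  have : cutPlane = (fun z : ℂ => 1 - z) '' slitPlane := by
    ext x
    constructor
    · intro hx
      exact ⟨1 - x, hx, by ring⟩
    · rintro ⟨z, hz, rfl⟩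
      change 1 - (1 - z) ∈ slitPlane
      rwa [sub_sub_cancel]
  rw [this]
  exact (starConvex_one_slitPlane.isPathConnected
    one_mem_slitPlane).isConnected.isPreconnected.image _ (by fun_prop)

/-- The factor `(1 - x t) ^ b (1 - y t) ^ c`. -/
noncomputable def appellFactor (b c : ℂ) (z : ℂ × ℂ) (t : ℝ) : ℂ :=
  (1 - z.1 * t) ^ b * (1 - z.2 * t) ^ c

theorem continuousOn_appellFactor_uncurry (b c : ℂ) :
    ContinuousOn (Function.uncurry (appellFactor b c)) ((cutPlane ×ˢ cutPlane) ×ˢ Icc 0 1) := by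
  unfold appellFactor Function.uncurry
  refine ContinuousOn.mul ?_ ?_
  · refine ContinuousOn.cpow_const (by fun_prop) fun q hq => ?_
    exact one_sub_mul_mem_slitPlane hq.1.1 hq.2.1 hq.2.2
  · refine ContinuousOn.cpow_const (by fun_prop) fun q hq => ?_
    exact one_sub_mul_mem_slitPlane hq.1.2 hq.2.1 hq.2.2

theorem continuousOn_appellFactor (b c : ℂ) {z : ℂ × ℂ} (hz : z ∈ cutPlane ×ˢ cutPlane) :
    ContinuousOn (appellFactor b c z) (Icc 0 1) :=
  (continuousOn_appellFactor_uncurry b c).comp (f := fun t : ℝ => (z, t)) (by fun_prop)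
    fun _ ht => ⟨hz, ht⟩

/-- The derivative of `appellFactor` in its first argument. -/
noncomputable def appellFactorDeriv (b c : ℂ) (z : ℂ × ℂ) (t : ℝ) : ℂ × ℂ →L[ℂ] ℂ :=
  (-(b * t) * appellFactor (b - 1) c z t) • ContinuousLinearMap.fst ℂ ℂ ℂ +
    (-(c * t) * appellFactor b (c - 1) z t) • ContinuousLinearMap.snd ℂ ℂ ℂ

theorem hasFDerivAt_appellFactor (b c : ℂ) {z : ℂ × ℂ} (hz : z ∈ cutPlane ×ˢ cutPlane) {t : ℝ}
    (h0 : 0 ≤ t) (h1 : t ≤ 1) :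
    HasFDerivAt (fun z => appellFactor b c z t) (appellFactorDeriv b c z t) z := by
  have d1 : HasFDerivAt (fun z : ℂ × ℂ => 1 - z.1 * t)
      (-((t : ℂ) • ContinuousLinearMap.fst ℂ ℂ ℂ)) z :=
    (hasFDerivAt_fst.mul_const (t : ℂ)).const_sub 1
  have d2 : HasFDerivAt (fun z : ℂ × ℂ => 1 - z.2 * t)
      (-((t : ℂ) • ContinuousLinearMap.snd ℂ ℂ ℂ)) z :=
    (hasFDerivAt_snd.mul_const (t : ℂ)).const_sub 1
  have h := (d1.cpow (hasFDerivAt_const b z) (one_sub_mul_mem_slitPlane hz.1 h0 h1)).mul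
    (d2.cpow (hasFDerivAt_const c z) (one_sub_mul_mem_slitPlane hz.2 h0 h1))
  refine h.congr_fderiv ?_
  ext <;> simp [appellFactorDeriv, appellFactor] <;> ring

theorem continuousOn_appellFactorDeriv_uncurry (b c : ℂ) :
    ContinuousOn (Function.uncurry (appellFactorDeriv b c))
      ((cutPlane ×ˢ cutPlane) ×ˢ Icc 0 1) := by
  have h1 := continuousOn_appellFactor_uncurry (b - 1) c
  have h2 := continuousOn_appellFactor_uncurry b (c - 1)
  unfold appellFactorDeriv
  unfold Function.uncurry at h1 h2 ⊢
  exact (((by fun_prop : ContinuousOn (fun q : (ℂ × ℂ) × ℝ => -(b * (q.2 : ℂ))) _).mul h1).smul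
    continuousOn_const).add (((by fun_prop : ContinuousOn
      (fun q : (ℂ × ℂ) × ℝ => -(c * (q.2 : ℂ))) _).mul h2).smul continuousOn_const)

theorem intervalIntegrable_mul_appellFactor {h : ℝ → ℂ} (hh : IntervalIntegrable h volume 0 1)
    (b c : ℂ) {z : ℂ × ℂ} (hz : z ∈ cutPlane ×ˢ cutPlane) :
    IntervalIntegrable (fun t => h t * appellFactor b c z t) volume 0 1 :=
  hh.mul_continuousOn (by rw [uIcc_of_le zero_le_one]; exact continuousOn_appellFactor b c hz)

/-- The derivative of the factor is continuous, hence bounded, on a compact neighbourhood times `[0,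
1]`; a multiple of `‖h‖` then dominates differentiation under the integral. -/
theorem differentiableOn_integral_appellFactor {h : ℝ → ℂ}
    (hh : IntervalIntegrable h volume 0 1) (b c : ℂ) :
    DifferentiableOn ℂ (fun z : ℂ × ℂ => ∫ t in (0 : ℝ)..1, h t * appellFactor b c z t)
      (cutPlane ×ˢ cutPlane) := by
  intro z₀ hz₀
  have hU : IsOpen (cutPlane ×ˢ cutPlane) := isOpen_cutPlane.prod isOpen_cutPlane
  obtain ⟨V, hV, hz₀V, hVU⟩ := exists_compact_subset hU hz₀
  obtain ⟨M, hM⟩ := (hV.prod (isCompact_Icc (a := (0 : ℝ)) (b := 1))).exists_bound_of_continuousOn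
    ((continuousOn_appellFactorDeriv_uncurry b c).mono (prod_mono hVU Subset.rfl))
  have hmem : ∀ t ∈ Set.uIoc (0 : ℝ) 1, t ∈ Icc (0 : ℝ) 1 := fun t ht => by
    rw [uIoc_of_le zero_le_one] at ht
    exact ⟨ht.1.le, ht.2⟩
  have hhm : AEStronglyMeasurable h (volume.restrict (Set.uIoc 0 1)) := hh.def'.aestronglyMeasurable
  refine (intervalIntegral.hasFDerivAt_integral_of_dominated_of_fderiv_le (𝕜 := ℂ)
    (F := fun z t => h t * appellFactor b c z t)
    (F' := fun z t => h t • appellFactorDeriv b c z t) (bound := fun t => ‖h t‖ * M)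
    (mem_interior_iff_mem_nhds.1 hz₀V) ?_ ?_ ?_ ?_ ?_ ?_).differentiableAt.differentiableWithinAt
  · filter_upwards [hU.mem_nhds hz₀] with z hz
    exact (intervalIntegrable_mul_appellFactor hh b c hz).def'.aestronglyMeasurable
  · exact intervalIntegrable_mul_appellFactor hh b c hz₀
  · refine hhm.smul (ContinuousOn.aestronglyMeasurable ?_ measurableSet_uIoc)
    exact ((continuousOn_appellFactorDeriv_uncurry b c).comp (f := fun t : ℝ => (z₀, t))
      (by fun_prop) fun t ht => ⟨hz₀, hmem t ht⟩)
  · refine .of_forall fun t ht z hz => ?_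
    rw [norm_smul]
    gcongr
    exact hM (z, t) ⟨hz, hmem t ht⟩
  · exact hh.norm.mul_const M
  · refine .of_forall fun t ht z hz => ?_
    exact (hasFDerivAt_appellFactor b c (hVU hz) (hmem t ht).1 (hmem t ht).2).const_mul (h t)

theorem ascPochhammer_eval_div_factorial (b : ℂ) (n : ℕ) :
    (ascPochhammer ℂ n).eval b / n.factorial = Ring.choose (b + n - 1) n := by
  rw [Ring.choose_eq_smul, Polynomial.descPochhammer_smeval_eq_ascPochhammer,
    Polynomial.ascPochhammer_smeval_cast, Polynomial.ascPochhammer_smeval_eq_eval,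
    show b + n - 1 - n + 1 = b by ring]
  rw [div_eq_inv_mul]
  simp [smul_eq_mul]

/-- The binomial series for `(1 - z) ^ (-b)`, with absolute convergence. -/
theorem hasSum_one_sub_cpow_neg (b : ℂ) {z : ℂ} (hz : ‖z‖ < 1) :
    HasSum (fun n : ℕ => (ascPochhammer ℂ n).eval b / n.factorial * z ^ n) ((1 - z) ^ (-b)) ∧
    Summable fun n : ℕ => ‖(ascPochhammer ℂ n).eval b / n.factorial * z ^ n‖ := by
  have h := one_div_one_sub_cpow_hasFPowerSeriesOnBall_zero b
  have hz' : z ∈ Metric.eball (0 : ℂ) 1 := by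
    rw [← ENNReal.ofReal_one, Metric.eball_ofReal]
    simpa using hz
  have h1 := h.hasSum hz'
  have h2 := FormalMultilinearSeries.summable_norm_apply _ (Metric.eball_subset_eball h.r_le hz')
  simp only [FormalMultilinearSeries.ofScalars_apply_eq, smul_eq_mul, zero_add,
    ← ascPochhammer_eval_div_factorial, one_div, ← cpow_neg] at h1 h2
  exact ⟨h1, h2⟩

/-- The Euler integral of the extended Appell function. -/
noncomputable def extAppellIntegral (p : ℂ) (ν : ℝ) (b1 b2 b3 c1 x y : ℂ) : ℂ :=
  (2 * p / Real.pi) ^ (1 / 2 : ℂ) / betaIntegral b1 (c1 - b1) *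
    ∫ t in (0 : ℝ)..1, extBetaKernel p ν b1 (c1 - b1) t * appellFactor (-b2) (-b3) (x, y) t

/-- For `0 < t ≤ 1` the product of the two binomial series is dominated termwise by its absolutely
summable value at `t = 1`, so it integrates term by term; the factor `t^(m+n)` shifts the first
argument of the extended Beta function. -/
theorem hasSum_extAppellTerm {p : ℂ} (hp : 0 < p.re) {ν : ℝ} (hν : 0 ≤ ν) (b1 b2 b3 c1 : ℂ)
    {x y : ℂ} (hx : ‖x‖ < 1) (hy : ‖y‖ < 1) :
    HasSum (extAppellTerm p ν b1 b2 b3 c1 x y) (extAppellIntegral p ν b1 b2 b3 c1 x y) := by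
  set h := extBetaKernel p ν b1 (c1 - b1) with hh
  have hint : IntervalIntegrable h volume 0 1 := intervalIntegrable_extBetaKernel hp hν _ _
  set u : ℂ → ℂ → ℕ → ℂ := fun b x n => (ascPochhammer ℂ n).eval b / n.factorial * x ^ n with hu
  have hux : Summable fun n => ‖u b2 x n‖ := (hasSum_one_sub_cpow_neg b2 hx).2
  have huy : Summable fun n => ‖u b3 y n‖ := (hasSum_one_sub_cpow_neg b3 hy).2
  have hprod : Summable fun mn : ℕ × ℕ => ‖u b2 x mn.1‖ * ‖u b3 y mn.2‖ :=
    hux.mul_of_nonneg huy (fun _ => norm_nonneg _) fun _ => norm_nonneg _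
  have key : HasSum (fun mn : ℕ × ℕ => ∫ t in (0 : ℝ)..1,
      h t * (u b2 (x * t) mn.1 * u b3 (y * t) mn.2))
      (∫ t in (0 : ℝ)..1, h t * appellFactor (-b2) (-b3) (x, y) t) := by
    refine intervalIntegral.hasSum_integral_of_dominated_convergence
      (fun mn t => ‖h t‖ * (‖u b2 x mn.1‖ * ‖u b3 y mn.2‖)) ?_ ?_ ?_ ?_ ?_
    · intro mn
      exact hint.def'.aestronglyMeasurable.mul
        (by fun_prop : Continuous fun t : ℝ =>
          u b2 (x * t) mn.1 * u b3 (y * t) mn.2).aestronglyMeasurable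
    · refine fun mn => .of_forall fun t ht => ?_
      rw [uIoc_of_le zero_le_one] at ht
      have hpow : ∀ (b z : ℂ) (n : ℕ), ‖u b (z * t) n‖ ≤ ‖u b z n‖ := by
        intro b z n
        simp only [hu, norm_mul, norm_pow, mul_pow, norm_real]
        have : ‖t‖ ^ n ≤ 1 := pow_le_one₀ (norm_nonneg _) (by
          rw [Real.norm_eq_abs, abs_of_pos ht.1]; exact ht.2)
        calc _ ≤ ‖(ascPochhammer ℂ n).eval b / n.factorial‖ * (‖z‖ ^ n * 1) := by gcongr
          _ = _ := by rw [mul_one]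
      rw [norm_mul, norm_mul]
      gcongr
      · exact hpow _ _ _
      · exact hpow _ _ _
    · exact .of_forall fun t _ => hprod.mul_left _
    · simp_rw [tsum_mul_left]
      exact hint.norm.mul_const _
    · refine .of_forall fun t ht => ?_
      rw [uIoc_of_le zero_le_one] at ht
      have hlt : ∀ z : ℂ, ‖z‖ < 1 → ‖z * t‖ < 1 := fun z hz => by
        rw [norm_mul, norm_real, Real.norm_eq_abs, abs_of_pos ht.1]
        nlinarith [ht.1, ht.2, norm_nonneg z]
      have s1 : HasSum (u b2 (x * t)) ((1 - x * t) ^ (-b2)) ∧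
        Summable fun n => ‖u b2 (x * t) n‖ := hasSum_one_sub_cpow_neg b2 (hlt x hx)
      have s2 : HasSum (u b3 (y * t)) ((1 - y * t) ^ (-b3)) ∧
        Summable fun n => ‖u b3 (y * t) n‖ := hasSum_one_sub_cpow_neg b3 (hlt y hy)
      have s3 := s1.1.mul s2.1 (summable_mul_of_summable_norm s1.2 s2.2)
      rw [appellFactor]
      exact s3.mul_left (h t)
  have := key.mul_left ((2 * p / Real.pi) ^ (1 / 2 : ℂ) / betaIntegral b1 (c1 - b1))
  refine this.congr_fun ?_
  rintro ⟨m, n⟩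
  have e : ∫ t in (0 : ℝ)..1, h t * (u b2 (x * t) m * u b3 (y * t) n) =
      (u b2 x m * u b3 y n) * ∫ t in (0 : ℝ)..1, (t : ℂ) ^ (b1 + m + n - 3 / 2) *
        (1 - (t : ℂ)) ^ (c1 - b1 - 3 / 2) * besselK ((ν : ℂ) + 1 / 2) (p / (t * (1 - t))) := by
    rw [← intervalIntegral.integral_const_mul]
    refine intervalIntegral.integral_congr_ae (.of_forall fun t ht => ?_)
    rw [uIoc_of_le zero_le_one] at ht
    have ht0 : (t : ℂ) ≠ 0 := by exact_mod_cast ht.1.ne'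
    have e1 : (t : ℂ) ^ (b1 + m + n - 3 / 2) = (t : ℂ) ^ (b1 - 3 / 2) * t ^ m * t ^ n := by
      rw [show b1 + m + n - 3 / 2 = (b1 - 3 / 2) + m + n by ring, cpow_add _ _ ht0,
        cpow_add _ _ ht0, cpow_natCast, cpow_natCast]
    rw [e1, hh, extBetaKernel, hu]
    simp only [mul_pow]
    ring
  rw [e, extAppellTerm, extBeta, hu]
  simp only
  ring

theorem isExtAppellF1_extAppellIntegral {p : ℂ} (hp : 0 < p.re) {ν : ℝ} (hν : 0 ≤ ν)
    (b1 b2 b3 c1 : ℂ) :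
    IsExtAppellF1 p ν b1 b2 b3 c1 (extAppellIntegral p ν b1 b2 b3 c1) where
  hasSum _ _ hx hy := hasSum_extAppellTerm hp hν b1 b2 b3 c1 hx hy
  holomorphic := (differentiableOn_integral_appellFactor
    (intervalIntegrable_extBetaKernel hp hν _ _) _ _).const_mul _

/-- The one-variable identity theorem is used twice: first in `x` with the second variable in the
unit disc, then in `y` with `x` anywhere in the cut plane. -/
theorem IsExtAppellF1.eq_of_mem_cutPlane {p : ℂ} {ν : ℝ} {b1 b2 b3 c1 : ℂ} {F G : ℂ → ℂ → ℂ}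
    (hF : IsExtAppellF1 p ν b1 b2 b3 c1 F) (hG : IsExtAppellF1 p ν b1 b2 b3 c1 G) {x y : ℂ}
    (hx : x ∈ cutPlane) (hy : y ∈ cutPlane) : F x y = G x y := by
  have h0 : (0 : ℂ) ∈ cutPlane := mem_cutPlane_of_norm_lt_one (by simp)
  have hball : ∀ᶠ z : ℂ in 𝓝 0, ‖z‖ < 1 := by
    filter_upwards [Metric.ball_mem_nhds (0 : ℂ) one_pos] with z hz
    simpa using hz
  have ax : ∀ H, IsExtAppellF1 p ν b1 b2 b3 c1 H → ∀ w ∈ cutPlane,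
      AnalyticOnNhd ℂ (fun z => H z w) cutPlane := fun H hH w hw =>
    (hH.holomorphic.comp (f := fun z : ℂ => (z, w)) (by fun_prop)
      fun z hz => ⟨hz, hw⟩).analyticOnNhd isOpen_cutPlane
  have ay : ∀ H, IsExtAppellF1 p ν b1 b2 b3 c1 H → ∀ w ∈ cutPlane,
      AnalyticOnNhd ℂ (fun z => H w z) cutPlane := fun H hH w hw =>
    (hH.holomorphic.comp (f := fun z : ℂ => (w, z)) (by fun_prop)
      fun z hz => ⟨hw, hz⟩).analyticOnNhd isOpen_cutPlane
  have step : ∀ w : ℂ, ‖w‖ < 1 → F x w = G x w := fun w hw =>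
    (ax F hF w (mem_cutPlane_of_norm_lt_one hw)).eqOn_of_preconnected_of_eventuallyEq
      (ax G hG w (mem_cutPlane_of_norm_lt_one hw)) isPreconnected_cutPlane h0
      (hball.mono fun z hz => (hF.hasSum z w hz hw).unique (hG.hasSum z w hz hw)) hx
  exact (ay F hF x hx).eqOn_of_preconnected_of_eventuallyEq (ay G hG x hx)
    isPreconnected_cutPlane h0 (hball.mono step) hy

theorem isExtAppellF1_extAppellF1 {p : ℂ} (hp : 0 < p.re) {ν : ℝ} (hν : 0 ≤ ν)
    (b1 b2 b3 c1 : ℂ) : IsExtAppellF1 p ν b1 b2 b3 c1 (extAppellF1 p ν b1 b2 b3 c1) := by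
  have h : ∃ F, IsExtAppellF1 p ν b1 b2 b3 c1 F :=
    ⟨_, isExtAppellF1_extAppellIntegral hp hν b1 b2 b3 c1⟩
  rw [extAppellF1, dif_pos h]
  exact h.choose_spec

theorem extAppellF1_eq_integral {p : ℂ} (hp : 0 < p.re) {ν : ℝ} (hν : 0 ≤ ν)
    (b1 b2 b3 c1 : ℂ) {x y : ℂ} (hx : x ∈ cutPlane) (hy : y ∈ cutPlane) :
    extAppellF1 p ν b1 b2 b3 c1 x y = extAppellIntegral p ν b1 b2 b3 c1 x y :=
  (isExtAppellF1_extAppellF1 hp hν b1 b2 b3 c1).eq_of_mem_cutPlane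
    (isExtAppellF1_extAppellIntegral hp hν b1 b2 b3 c1) hx hy

end ExtendedAppell

/-! ### Assembling the five representations. -/

section Representations
open Complex MeasureTheory Set Filter Topology

theorem eqConstMulIntegral_of_eq_const_mul {V A A' c : ℂ} {f g : ℝ → ℂ}
    (hg : IntervalIntegrable g volume 0 1) (hV : V = A * ∫ t in (0 : ℝ)..1, g t)
    (hf : ∀ t : ℝ, 0 < t → t < 1 → f t = c * g t) (hA : A' * c = A) :
    EqConstMulIntegral V A' f := by
  have hae : ∀ᵐ t : ℝ ∂volume, t ∈ Set.uIoc (0 : ℝ) 1 → c * g t = f t := by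
    filter_upwards [Measure.ae_ne volume (1 : ℝ)] with t ht1 ht
    rw [uIoc_of_le zero_le_one] at ht
    exact (hf t ht.1 (lt_of_le_of_ne ht.2 ht1)).symm
  constructor
  · exact (hg.const_mul c).congr_ae ((ae_restrict_iff' measurableSet_uIoc).2 hae)
  · rw [← intervalIntegral.integral_congr_ae hae, intervalIntegral.integral_const_mul, ← mul_assoc,
      hA, hV]

theorem log_div_mul_one_sub {q : ℂ} (hq : q ≠ 0) {t : ℝ} (h0 : 0 < t) (h1 : t < 1) :
    log (q / (t * (1 - t))) = log q - log t - log (1 - t) := by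
  have h1' : 0 < 1 - t := by linarith
  have := log_div_ofReal hq (mul_pos h0 h1')
  rw [← ofReal_log (by positivity), Real.log_mul h0.ne' h1'.ne'] at this
  rw [ofReal_add, ofReal_log h0.le, ofReal_log h1'.le] at this
  push_cast at this
  rw [this]
  ring

/-- As `t(1 - t)` is positive, the logarithm of the quotient splits exactly, and `(q / (t(1-t)))^μ`
cancels the shift of the exponents by `μ`. -/
theorem cpow_shift_mul_exp_log {q : ℂ} (hq : q ≠ 0) (a d μ : ℂ) {t : ℝ} (h0 : 0 < t) (h1 : t < 1) :
    (t : ℂ) ^ (a + μ - 3 / 2) * (1 - (t : ℂ)) ^ (d + μ - 3 / 2) *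
      cexp (μ * log (q / (t * (1 - t)))) =
    (t : ℂ) ^ (a - 3 / 2) * (1 - (t : ℂ)) ^ (d - 3 / 2) * cexp (μ * log q) := by
  have ht : (t : ℂ) ≠ 0 := by exact_mod_cast h0.ne'
  have ht' : (1 - (t : ℂ)) ≠ 0 := by
    have : 1 - t ≠ 0 := by linarith
    exact_mod_cast this
  rw [log_div_mul_one_sub hq h0 h1, cpow_def_of_ne_zero ht, cpow_def_of_ne_zero ht',
    cpow_def_of_ne_zero ht, cpow_def_of_ne_zero ht']
  simp only [← Complex.exp_add]
  congr 1
  ring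

/-- `|arg w| < π/2`, so doubling the argument stays within the principal branch. -/
theorem log_sq_of_re_pos {w : ℂ} (hw : 0 < w.re) : log (w ^ 2) = 2 * log w := by
  have hw0 : w ≠ 0 := by rintro rfl; simp at hw
  have harg := abs_lt.1 (abs_arg_lt_pi_div_two_iff.2 (Or.inl hw))
  nth_rewrite 1 [← exp_log hw0]
  rw [← Complex.exp_nat_mul, log_exp] <;> simp [log_im] <;> linarith

end Representations

theorem theorem1 (p : ℂ) (hp : 0 < p.re) (ν : ℝ) (hν : 0 ≤ ν) (b1 b2 b3 c1 : ℂ)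
    (hb1 : 0 < b1.re) (hc1 : b1.re < c1.re) :
    IsExtAppellF1 p ν b1 b2 b3 c1 (extAppellF1 p ν b1 b2 b3 c1) ∧
    ∀ x y : ℂ, x ∈ cutPlane → y ∈ cutPlane →
      EqConstMulIntegral (extAppellF1 p ν b1 b2 b3 c1 x y)
        (Complex.Gamma c1 * (2 * p) ^ (1 / 2 : ℂ) / (Complex.Gamma b1 * Complex.Gamma (c1 - b1)))
        (fun t : ℝ =>
          (t : ℂ) ^ (b1 - 3 / 2) * (1 - (t : ℂ)) ^ (c1 - b1 - 3 / 2) *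
            (1 - x * t) ^ (-b2) * (1 - y * t) ^ (-b3) *
            Complex.exp (p / (t * (1 - t))) *
            meijerG [] [1 / 2] [(ν : ℂ) + 1 / 2, -(ν : ℂ) - 1 / 2] [] (2 * p / (t * (1 - t)))) ∧
      ((∀ k : ℕ, ν ≠ k) →
        EqConstMulIntegral (extAppellF1 p ν b1 b2 b3 c1 x y)
          (Complex.Gamma c1 * (2 * p) ^ (1 / 2 : ℂ) /
              (Complex.Gamma b1 * Complex.Gamma (c1 - b1)) *
            (Complex.cos (Real.pi * ((ν : ℂ) + 1 / 2)) / Real.pi))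
          (fun t : ℝ =>
            (t : ℂ) ^ (b1 - 3 / 2) * (1 - (t : ℂ)) ^ (c1 - b1 - 3 / 2) *
              (1 - x * t) ^ (-b2) * (1 - y * t) ^ (-b3) *
              Complex.exp (-p / (t * (1 - t))) *
              meijerG [1 / 2] [] [(ν : ℂ) + 1 / 2, -(ν : ℂ) - 1 / 2] []
                (2 * p / (t * (1 - t))))) ∧
      ∀ μ : ℂ,
        EqConstMulIntegral (extAppellF1 p ν b1 b2 b3 c1 x y)
          (Complex.Gamma c1 * 2 ^ (μ - 1 / 2) * p ^ (-μ + 1 / 2) /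
            ((Real.sqrt Real.pi : ℂ) * Complex.Gamma b1 * Complex.Gamma (c1 - b1)))
          (fun t : ℝ =>
            (t : ℂ) ^ (b1 + μ - 3 / 2) * (1 - (t : ℂ)) ^ (c1 - b1 + μ - 3 / 2) *
              (1 - x * t) ^ (-b2) * (1 - y * t) ^ (-b3) *
              meijerG [] [] [(2 * μ + 2 * ν + 1) / 4, (2 * μ - 2 * ν - 1) / 4] []
                (p ^ 2 / (4 * t ^ 2 * (1 - t) ^ 2))) ∧
        ((∀ k : ℕ, ν ≠ k) →
          EqConstMulIntegral (extAppellF1 p ν b1 b2 b3 c1 x y)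
            (Complex.Gamma c1 * (2 * p) ^ (-μ + 1 / 2) /
                (Complex.Gamma b1 * Complex.Gamma (c1 - b1)) *
              (Complex.cos (Real.pi * ((ν : ℂ) + 1 / 2)) / Real.pi))
            (fun t : ℝ =>
              (t : ℂ) ^ (b1 + μ - 3 / 2) * (1 - (t : ℂ)) ^ (c1 - b1 + μ - 3 / 2) *
                (1 - x * t) ^ (-b2) * (1 - y * t) ^ (-b3) *
                Complex.exp (-p / (t * (1 - t))) *
                meijerG [(2 * μ + 1) / 2] []
                  [(2 * μ + 2 * ν + 1) / 2, (2 * μ - 2 * ν - 1) / 2] []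
                  (2 * p / (t * (1 - t))))) ∧
        EqConstMulIntegral (extAppellF1 p ν b1 b2 b3 c1 x y)
          (Complex.Gamma c1 * p ^ (-μ + 1 / 2) * 2 ^ (2 * μ - 3 / 2) /
            (Complex.Gamma b1 * Complex.Gamma (c1 - b1) * (Real.pi : ℂ) ^ (3 / 2 : ℂ)))
          (fun t : ℝ =>
            (t : ℂ) ^ (b1 + μ - 3 / 2) * (1 - (t : ℂ)) ^ (c1 - b1 + μ - 3 / 2) *
              (1 - x * t) ^ (-b2) * (1 - y * t) ^ (-b3) *
              meijerGLog [] []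
                [(2 * μ + 2 * ν + 1) / 8, (2 * μ + 2 * ν + 5) / 8,
                  (2 * μ - 2 * ν - 1) / 8, (2 * μ - 2 * ν + 3) / 8] []
                (4 * Complex.log (p / (4 * t * (1 - t))))) := by
  have hp0 : p ≠ 0 := by rintro rfl; simp at hp
  have h2p : 2 * p ≠ 0 := by simpa using hp0
  have hp2 : p / 2 ≠ 0 := by simpa using hp0
  have hs : (Real.sqrt Real.pi : ℂ) ≠ 0 := by
    exact_mod_cast (Real.sqrt_pos.2 Real.pi_pos).ne'
  have hss : (Real.sqrt Real.pi : ℂ) * Real.sqrt Real.pi = Real.pi := by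
    rw [← Complex.ofReal_mul, Real.mul_self_sqrt Real.pi_pos.le]
  have hπ0 : (Real.pi : ℂ) ≠ 0 := by exact_mod_cast Real.pi_ne_zero
  have hlog2p : Complex.log (2 * p) = Complex.log 2 + Complex.log p := by
    have := Complex.log_ofReal_mul (r := 2) two_pos hp0
    rwa [Complex.ofReal_log two_pos.le, Complex.ofReal_ofNat] at this
  have hlogp2 : Complex.log (p / 2) = Complex.log p - Complex.log 2 := by
    have := log_div_ofReal hp0 (r := 2) two_pos
    rwa [Complex.ofReal_ofNat] at this
  have hsqrt : (Real.pi : ℂ) ^ (1 / 2 : ℂ) = Real.sqrt Real.pi := by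
    rw [Real.sqrt_eq_rpow, Complex.ofReal_cpow Real.pi_pos.le]
    norm_num
  have hb1' : Complex.Gamma b1 ≠ 0 := Complex.Gamma_ne_zero_of_re_pos hb1
  have hcb : 0 < (c1 - b1).re := by rw [Complex.sub_re]; linarith
  have hcb' : Complex.Gamma (c1 - b1) ≠ 0 := Complex.Gamma_ne_zero_of_re_pos hcb
  have hc1' : Complex.Gamma c1 ≠ 0 := Complex.Gamma_ne_zero_of_re_pos (by linarith)
  -- The conditions on `b1` and `c1` serve to turn the Beta function into Gamma values; the Euler
  -- integral converges without them.
  have hA : (2 * p / Real.pi) ^ (1 / 2 : ℂ) / Complex.betaIntegral b1 (c1 - b1) =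
      Complex.Gamma c1 * (2 * p) ^ (1 / 2 : ℂ) / (Complex.Gamma b1 * Complex.Gamma (c1 - b1)) /
        Real.sqrt Real.pi := by
    have h1 : (2 * p / Real.pi) ^ (1 / 2 : ℂ) = (2 * p) ^ (1 / 2 : ℂ) / Real.sqrt Real.pi := by
      rw [← hsqrt, ← cexp_mul_log_eq_cpow (div_ne_zero h2p hπ0), log_div_ofReal h2p Real.pi_pos,
        ← cexp_mul_log_eq_cpow h2p, ← cexp_mul_log_eq_cpow hπ0, ← Complex.exp_sub, mul_sub]
    rw [h1, Complex.betaIntegral_eq_Gamma_mul_div _ _ hb1 hcb, add_sub_cancel]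
    field_simp
  have hpow3 : (Real.pi : ℂ) ^ (3 / 2 : ℂ) = Real.pi * Real.sqrt Real.pi := by
    rw [← hsqrt, show (3 / 2 : ℂ) = 1 + 1 / 2 by norm_num, Complex.cpow_add _ _ hπ0,
      Complex.cpow_one]
  have h2e : (2 : ℂ) = Complex.exp (Complex.log 2) := (Complex.exp_log two_ne_zero).symm
  refine ⟨isExtAppellF1_extAppellF1 hp hν b1 b2 b3 c1, fun x y hx hy => ?_⟩
  have hI := intervalIntegrable_mul_appellFactor
    (intervalIntegrable_extBetaKernel hp hν b1 (c1 - b1)) (-b2) (-b3) (z := (x, y)) ⟨hx, hy⟩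
  have hV := extAppellF1_eq_integral hp hν b1 b2 b3 c1 hx hy
  rw [extAppellIntegral, hA] at hV
  have hz : ∀ t : ℝ, 0 < t → t < 1 → 0 < (p / (t * (1 - t))).re := fun t h0 h1 => by
    have h1' : 0 < 1 - t := by linarith
    rw [show p / (t * (1 - t)) = p / ((t * (1 - t) : ℝ) : ℂ) by push_cast; rfl,
      Complex.div_ofReal_re]
    positivity
  have hexp : ∀ w : ℂ, Complex.exp w * Complex.exp (-w) = 1 := fun w => by
    rw [← Complex.exp_add]; simp
  -- The cosine vanishes exactly when `ν` is an integer, and `ν ≥ 0` makes that integer natural.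
  have hcos : (∀ k : ℕ, ν ≠ k) → Complex.cos (Real.pi * ((ν : ℂ) + 1 / 2)) ≠ 0 := by
    intro hν' h
    obtain ⟨k, hk⟩ := Complex.cos_eq_zero_iff.1 h
    have h1 : (ν : ℂ) = k := by
      have h2 : (Real.pi : ℂ) * ((ν : ℂ) + 1 / 2) = Real.pi * (k + 1 / 2) := by rw [hk]; ring
      exact add_right_cancel (mul_left_cancel₀ hπ0 h2)
    have h3 : ν = (k : ℝ) := by exact_mod_cast h1
    have hk0 : 0 ≤ k := by
      have : (0 : ℝ) ≤ k := h3 ▸ hν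
      exact_mod_cast this
    refine hν' k.toNat ?_
    rw [h3]
    exact_mod_cast (Int.toNat_of_nonneg hk0).symm
  refine ⟨?_, ?_, fun μ => ⟨?_, ?_, ?_⟩⟩
  · refine eqConstMulIntegral_of_eq_const_mul (c := (Real.sqrt Real.pi : ℂ)⁻¹) hI hV
      (fun t h0 h1 => ?_) (by rw [div_eq_mul_inv _ (Real.sqrt Real.pi : ℂ)])
    rw [mul_div_assoc 2 p, meijerG_two_zero_one_two hν (hz t h0 h1), extBetaKernel, appellFactor]
    linear_combination ((t : ℂ) ^ (b1 - 3 / 2) * (1 - (t : ℂ)) ^ (c1 - b1 - 3 / 2) *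
      (1 - x * t) ^ (-b2) * (1 - y * t) ^ (-b3) * (Real.sqrt Real.pi : ℂ)⁻¹ *
      besselK ((ν : ℂ) + 1 / 2) (p / (t * (1 - t)))) * hexp (p / (t * (1 - t)))
  · intro hν'
    have hc := hcos hν'
    refine eqConstMulIntegral_of_eq_const_mul
      (c := Real.sqrt Real.pi / Complex.cos (Real.pi * ((ν : ℂ) + 1 / 2))) hI hV
      (fun t h0 h1 => ?_) ?_
    -- Representation (2) uses the evaluation behind (4) at `μ = 0`.
    · have hG := meijerG_two_one_one_two hν hν' 0 (hz t h0 h1)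
      rw [zero_add, zero_add, zero_sub, zero_mul, Complex.exp_zero, one_mul,
        show -((ν : ℂ) + 1 / 2) = -(ν : ℂ) - 1 / 2 by ring] at hG
      rw [mul_div_assoc 2 p, hG, neg_div, extBetaKernel, appellFactor]
      linear_combination ((t : ℂ) ^ (b1 - 3 / 2) * (1 - (t : ℂ)) ^ (c1 - b1 - 3 / 2) *
        (1 - x * t) ^ (-b2) * (1 - y * t) ^ (-b3) *
        (Real.sqrt Real.pi / Complex.cos (Real.pi * ((ν : ℂ) + 1 / 2))) *
        besselK ((ν : ℂ) + 1 / 2) (p / (t * (1 - t)))) * hexp (p / (t * (1 - t)))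
    · generalize Complex.cos (Real.pi * ((ν : ℂ) + 1 / 2)) = C at hc ⊢
      rw [← hss]
      field_simp
  · refine eqConstMulIntegral_of_eq_const_mul
      (c := 2 * Complex.exp (μ * Complex.log (p / 2))) hI hV (fun t h0 h1 => ?_) ?_
    · have hz2 : 0 < (p / (t * (1 - t)) / 2).re := by
        rw [← Complex.ofReal_ofNat, Complex.div_ofReal_re]
        exact half_pos (hz t h0 h1)
      have hG := meijerGLog_two_zero_zero_two hν μ (hz t h0 h1)
      -- `z/2` has positive real part, so the lifted argument `2 log(z/2)` is the principal
      -- logarithm of its square.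
      rw [← log_sq_of_re_pos hz2, ← meijerG,
        show (μ + ((ν : ℂ) + 1 / 2)) / 2 = (2 * μ + 2 * ν + 1) / 4 by ring,
        show (μ - ((ν : ℂ) + 1 / 2)) / 2 = (2 * μ - 2 * ν - 1) / 4 by ring,
        show (p / (t * (1 - t)) / 2) ^ 2 = p ^ 2 / (4 * t ^ 2 * (1 - t) ^ 2) by
          rw [div_div, div_pow]; ring] at hG
      have hsh := cpow_shift_mul_exp_log hp2 b1 (c1 - b1) μ h0 h1
      rw [hG, extBetaKernel, appellFactor, div_right_comm]
      linear_combination (2 * (1 - x * t) ^ (-b2) * (1 - y * t) ^ (-b3) *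
        besselK ((ν : ℂ) + 1 / 2) (p / (t * (1 - t)))) * hsh
    · have key : (2 : ℂ) ^ (μ - 1 / 2) * p ^ (-μ + 1 / 2) *
          (2 * Complex.exp (μ * Complex.log (p / 2))) = (2 * p) ^ (1 / 2 : ℂ) := by
        rw [← cexp_mul_log_eq_cpow two_ne_zero, ← cexp_mul_log_eq_cpow hp0,
          ← cexp_mul_log_eq_cpow h2p, hlogp2, hlog2p]
        rw [show 2 * Complex.exp (μ * (Complex.log p - Complex.log 2)) =
          Complex.exp (Complex.log 2) * Complex.exp (μ * (Complex.log p - Complex.log 2)) by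
            rw [← h2e]]
        simp only [← Complex.exp_add]
        congr 1
        ring
      rw [← key]
      field_simp
  · intro hν'
    have hc := hcos hν'
    refine eqConstMulIntegral_of_eq_const_mul
      (c := Complex.exp (μ * Complex.log (2 * p)) *
        (Real.sqrt Real.pi / Complex.cos (Real.pi * ((ν : ℂ) + 1 / 2)))) hI hV
      (fun t h0 h1 => ?_) ?_
    · have hG := meijerG_two_one_one_two hν hν' μ (hz t h0 h1)
      rw [show μ + 1 / 2 = (2 * μ + 1) / 2 by ring,
        show μ + ((ν : ℂ) + 1 / 2) = (2 * μ + 2 * ν + 1) / 2 by ring,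
        show μ - ((ν : ℂ) + 1 / 2) = (2 * μ - 2 * ν - 1) / 2 by ring, ← mul_div_assoc] at hG
      have hsh := cpow_shift_mul_exp_log h2p b1 (c1 - b1) μ h0 h1
      rw [hG, neg_div, extBetaKernel, appellFactor]
      have he := hexp (p / (t * (1 - t)))
      set z := p / (t * (1 - t))
      set Q := Real.sqrt Real.pi / Complex.cos (Real.pi * ((ν : ℂ) + 1 / 2))
      calc _ = ((t : ℂ) ^ (b1 + μ - 3 / 2) * (1 - (t : ℂ)) ^ (c1 - b1 + μ - 3 / 2) *
            Complex.exp (μ * Complex.log (2 * p / (t * (1 - t))))) * Q *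
            (1 - x * t) ^ (-b2) * (1 - y * t) ^ (-b3) * besselK ((ν : ℂ) + 1 / 2) z *
            (Complex.exp z * Complex.exp (-z)) := by ring
        _ = _ := by rw [he, hsh]; ring
    · have key : (2 * p) ^ (-μ + 1 / 2) * Complex.exp (μ * Complex.log (2 * p)) =
          (2 * p) ^ (1 / 2 : ℂ) := by
        rw [← cexp_mul_log_eq_cpow h2p, ← cexp_mul_log_eq_cpow h2p, ← Complex.exp_add]
        congr 1
        ring
      generalize Complex.cos (Real.pi * ((ν : ℂ) + 1 / 2)) = C at hc ⊢
      rw [← key, ← hss]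
      field_simp
  · refine eqConstMulIntegral_of_eq_const_mul
      -- The constant is `4π (p/4)^μ`, split so that `cpow_shift_mul_exp_log` applies with `q =
      -- p/2`. A fourth power can leave the principal branch, so the lifted logarithm is kept here.
      (c := 4 * Real.pi * (Complex.exp (μ * Complex.log (p / 2)) *
        Complex.exp (-(μ * Complex.log 2)))) hI hV (fun t h0 h1 => ?_) ?_
    · have hG := meijerGLog_four_zero_zero_four hν μ (hz t h0 h1)
      rw [show (μ + ((ν : ℂ) + 1 / 2)) / 4 + 1 / 2 = (2 * μ + 2 * ν + 5) / 8 by ring,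
        show (μ + ((ν : ℂ) + 1 / 2)) / 4 = (2 * μ + 2 * ν + 1) / 8 by ring,
        show (μ - ((ν : ℂ) + 1 / 2)) / 4 + 1 / 2 = (2 * μ - 2 * ν + 3) / 8 by ring,
        show (μ - ((ν : ℂ) + 1 / 2)) / 4 = (2 * μ - 2 * ν - 1) / 8 by ring,
        show p / (t * (1 - t)) / 4 = p / (4 * t * (1 - t)) by rw [div_div]; ring,
        show μ * (Complex.log (p / (t * (1 - t)) / 2) - Complex.log 2) =
          μ * Complex.log (p / (t * (1 - t)) / 2) + -(μ * Complex.log 2) by ring,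
        Complex.exp_add] at hG
      have hsh := cpow_shift_mul_exp_log hp2 b1 (c1 - b1) μ h0 h1
      rw [hG, extBetaKernel, appellFactor, div_right_comm]
      linear_combination (4 * Real.pi * Complex.exp (-(μ * Complex.log 2)) *
        (1 - x * t) ^ (-b2) * (1 - y * t) ^ (-b3) *
        besselK ((ν : ℂ) + 1 / 2) (p / (t * (1 - t)))) * hsh
    · have key : p ^ (-μ + 1 / 2) * (2 : ℂ) ^ (2 * μ - 3 / 2) * (4 *
          (Complex.exp (μ * Complex.log (p / 2)) * Complex.exp (-(μ * Complex.log 2)))) =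
          (2 * p) ^ (1 / 2 : ℂ) := by
        have h4 : (4 : ℂ) = Complex.exp (2 * Complex.log 2) := by
          rw [two_mul, Complex.exp_add, ← h2e]; norm_num
        rw [← cexp_mul_log_eq_cpow two_ne_zero, ← cexp_mul_log_eq_cpow hp0,
          ← cexp_mul_log_eq_cpow h2p, hlogp2, hlog2p, h4]
        simp only [← Complex.exp_add]
        congr 1
        ring
      rw [← key, hpow3]
      field_simp
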